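/- Let $\mathrm{M}$ be a loopless matroid of rank $d$ on a finite set $E$. The augmented Chow ring of $\mathrm{M}$ is the graded $\mathbb{Q}$-algebra $$\mathrm{CH}(\mathrm{M})=\mathbb{Q}\big[y_e\ (e\in E),\ x_F\ (F \text{ a proper flat of } \mathrm{M})\big]/(I_{\mathrm{M}}+J_{\mathrm{M}}),$$ where all variables have degree $1$, $I_{\mathrm{M}}$ is generated by the linear forms $y_e-\sum_{F\not\ni e}x_F$ for $e\in E$, and $J_{\mathrm{M}}$ is generated by the monomials $x_{F_1}x_{F_2}$ for incomparable proper flats $F_1,F_2$ and $y_e x_F$ for $e\notin F$. There is a unique linear map $\deg_{\mathrm{M}}:\mathrm{CH}^d(\mathrm{M})\to\mathbb{Q}$ (the degree map) with $\deg_{\mathrm{M}}\big(\prod_{e\in I}y_e\prod_{F\in\mathscr{F}}x_F\big)=1$ whenever $I$ is an independent set, $\mathscr{F}$ is a flag of proper flats each containing $I$, and $|I|+|\mathscr{F}|=d$. The Poincaré pairing is $\mathrm{CH}^k(\mathrm{M})\times\mathrm{CH}^{d-k}(\mathrm{M})\to\mathbb{Q}$, $(\eta_1,\eta_2)\mapsto\deg_{\mathrm{M}}(\eta_1\eta_2)$.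 Let $i\in E$, let $\mathrm{M}\setminus i$ be the deletion, and let $\theta_i:\mathrm{CH}(\mathrm{M}\setminus i)\to\mathrm{CH}(\mathrm{M})$ be the graded algebra homomorphism with $x_F\mapsto x_F+x_{F\cup i}$ and $y_e\mapsto y_e$, where a variable in the target is set to zero if its label is not a flat of $\mathrm{M}$. Regard $\mathrm{CH}(\mathrm{M})$ as a $\mathrm{CH}(\mathrm{M}\setminus i)$-module through $\theta_i$, let $\mathrm{CH}_{(i)}$ be the image of $\theta_i$, and let $\mathscr{S}_i$ be the collection of proper subsets $F$ of $E\setminus i$ such that $F$ and $F\cup i$ are both flats of $\mathrm{M}$. 1. If $i$ is not a coloop of $\mathrm{M}$, there is a direct sum decomposition of $\mathrm{CH}(\mathrm{M})$ into indecomposable (in particular nonzero) cyclic graded $\mathrm{CH}(\mathrm{M}\setminus i)$-modules $$\mathrm{CH}(\mathrm{M})=\mathrm{CH}_{(i)}\oplus\bigoplus_{F\in\mathscr{S}_i}x_{F\cup i}\,\mathrm{CH}_{(i)},$$ and all pairs of distinct summands are orthogonal for the Poincaré pairing of $\mathrm{CH}(\mathrm{M})$. 2. If $i$ is a coloop of $\mathrm{M}$,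 there is a direct sum decomposition of $\mathrm{CH}(\mathrm{M})$ into indecomposable (in particular nonzero) cyclic graded $\mathrm{CH}(\mathrm{M}\setminus i)$-modules $$\mathrm{CH}(\mathrm{M})=\mathrm{CH}_{(i)}\oplus x_{E\setminus i}\,\mathrm{CH}_{(i)}\oplus\bigoplus_{F\in\mathscr{S}_i}x_{F\cup i}\,\mathrm{CH}_{(i)},$$ and all pairs of distinct summands except for the first two are orthogonal for the Poincaré pairing of $\mathrm{CH}(\mathrm{M})$; the first two are not orthogonal. Here indecomposability holds already in the category of ungraded modules. -/

import Mathlib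

noncomputable section

namespace Matroid

open Set MvPolynomial

universe u

variable {α : Type u}

/-- The proper flats of `M`: the flats different from the ground set. -/
def ProperFlat (M : Matroid α) : Type u := {F : Set α // M.IsFlat F ∧ F ≠ M.E}

instance ProperFlat.finite (M : Matroid α) [M.Finite] : Finite M.ProperFlat :=
  haveI : Finite {S : Set α // S ∈ 𝒫 M.E} := M.ground_finite.finite_subsets.to_subtype
  Finite.of_injective
    (fun F : M.ProperFlat ↦ (⟨F.1, F.2.1.subset_ground⟩ : {S : Set α // S ∈ 𝒫 M.E}))
    (fun _ _ h ↦ Subtype.ext (congrArg (fun S : {S : Set α // S ∈ 𝒫 M.E} ↦ S.1) h))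

instance ProperFlat.fintype (M : Matroid α) [M.Finite] : Fintype M.ProperFlat :=
  Fintype.ofFinite _

/-- The polynomial ring over `ℚ` in the variables `y_e` (for `e` in the ground set) and `x_F`
(for `F` a proper flat). -/
abbrev ChowPoly (M : Matroid α) : Type u := MvPolynomial (↥M.E ⊕ M.ProperFlat) ℚ

/-- The ideal generated by the linear forms `y_e - ∑_{e ∉ F} x_F`. -/
def linearIdeal (M : Matroid α) [M.Finite] : Ideal M.ChowPoly :=
  open scoped Classical in
  Ideal.span {p | ∃ e : ↥M.E,
    p = X (Sum.inl e) - ∑ F : M.ProperFlat with e.1 ∉ F.1, X (Sum.inr F)}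

/-- The ideal generated by the monomials `x_{F₁} x_{F₂}` for incomparable proper flats, and
`y_e x_F` for `e ∉ F`. -/
def quadraticIdeal (M : Matroid α) : Ideal M.ChowPoly :=
  Ideal.span
    ({p | ∃ F₁ F₂ : M.ProperFlat, ¬ F₁.1 ⊆ F₂.1 ∧ ¬ F₂.1 ⊆ F₁.1 ∧
        p = X (Sum.inr F₁) * X (Sum.inr F₂)} ∪
     {p | ∃ (e : ↥M.E) (F : M.ProperFlat), e.1 ∉ F.1 ∧ p = X (Sum.inl e) * X (Sum.inr F)})

/-- The augmented Chow ring `CH(M)`. -/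
def AugChow (M : Matroid α) [M.Finite] : Type u :=
  M.ChowPoly ⧸ (M.linearIdeal + M.quadraticIdeal)

instance (M : Matroid α) [M.Finite] : CommRing M.AugChow :=
  inferInstanceAs (CommRing (M.ChowPoly ⧸ (M.linearIdeal + M.quadraticIdeal)))

instance (M : Matroid α) [M.Finite] : Algebra ℚ M.AugChow :=
  inferInstanceAs (Algebra ℚ (M.ChowPoly ⧸ (M.linearIdeal + M.quadraticIdeal)))

/-- The quotient map onto `CH(M)`. -/
def chowMk (M : Matroid α) [M.Finite] : M.ChowPoly →ₐ[ℚ] M.AugChow :=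
  Ideal.Quotient.mkₐ ℚ (M.linearIdeal + M.quadraticIdeal)

/-- The class of the variable `y_e`. -/
def chowY (M : Matroid α) [M.Finite] (e : ↥M.E) : M.AugChow := M.chowMk (X (Sum.inl e))

open scoped Classical in
/-- The class of the variable `x_S`, set to zero if `S` is not a proper flat. -/
def chowX (M : Matroid α) [M.Finite] (S : Set α) : M.AugChow :=
  if h : M.IsFlat S ∧ S ≠ M.E then M.chowMk (X (Sum.inr ⟨S, h⟩)) else 0

/-- The graded piece `CH^k(M)`. -/
def chowGr (M : Matroid α) [M.Finite] (k : ℕ) : Submodule ℚ M.AugChow :=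
  (homogeneousSubmodule (↥M.E ⊕ M.ProperFlat) ℚ k).map M.chowMk.toLinearMap

theorem chowGr_mul_mem (M : Matroid α) [M.Finite] {k l n : ℕ} (h : k + l = n) {a b : M.AugChow}
    (ha : a ∈ M.chowGr k) (hb : b ∈ M.chowGr l) : a * b ∈ M.chowGr n := by
  obtain ⟨p, hp, rfl⟩ := ha
  obtain ⟨q, hq, rfl⟩ := hb
  subst h
  exact ⟨p * q, IsHomogeneous.mul hp hq, map_mul M.chowMk p q⟩

theorem chowMonomial_mem (M : Matroid α) [M.Finite] {n : ℕ} (I : Finset ↥M.E)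
    (𝓕 : Finset M.ProperFlat) (h : I.card + 𝓕.card = n) :
    (∏ e ∈ I, M.chowY e) * ∏ F ∈ 𝓕, M.chowX F.1 ∈ M.chowGr n := by
  refine M.chowGr_mul_mem h ?_ ?_
  · refine ⟨∏ e ∈ I, X (Sum.inl e), ?_, map_prod M.chowMk _ _⟩
    simpa using IsHomogeneous.prod I (fun e ↦ (X (Sum.inl e) : M.ChowPoly)) (fun _ ↦ 1)
      (fun e _ ↦ isHomogeneous_X ℚ _)
  · refine ⟨∏ F ∈ 𝓕, X (Sum.inr F), ?_, ?_⟩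
    · simpa using IsHomogeneous.prod 𝓕 (fun e ↦ (X (Sum.inr e) : M.ChowPoly)) (fun _ ↦ 1)
        (fun e _ ↦ isHomogeneous_X ℚ _)
    · refine (map_prod M.chowMk _ _).trans (Finset.prod_congr rfl fun F _ ↦ ?_)
      rw [chowX, dif_pos F.2]
      rfl

/-- The rank of a finite matroid as a natural number. -/
def natRank (M : Matroid α) : ℕ := M.eRank.toNat

/-- `I ≤ 𝓕` is a compatible pair: `I` is an independent set, `𝓕` is a flag of proper flats, and
`I` is contained in every member of `𝓕`. -/
structure CompatiblePair (M : Matroid α) (I : Finset ↥M.E) (𝓕 : Finset M.ProperFlat) :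
    Prop where
  indep : M.Indep (Subtype.val '' (I : Set ↥M.E))
  flag : ∀ F ∈ 𝓕, ∀ G ∈ 𝓕, F.1 ⊆ G.1 ∨ G.1 ⊆ F.1
  compatible : ∀ e ∈ I, ∀ F ∈ 𝓕, e.1 ∈ F.1

/-- `deg : CH^d(M) → ℚ`, where `d` is the rank of `M`, is the degree map: it takes the value `1` on
the monomial `y_I x_𝓕` of every maximal compatible pair `I ≤ 𝓕`, that is, one
with `|I| + |𝓕| = d`. -/
def IsDegreeMap (M : Matroid α) [M.Finite] (deg : M.chowGr M.natRank →ₗ[ℚ] ℚ) : Prop :=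
  ∀ (I : Finset ↥M.E) (𝓕 : Finset M.ProperFlat) (h : I.card + 𝓕.card = M.natRank),
    M.CompatiblePair I 𝓕 →
      deg ⟨(∏ e ∈ I, M.chowY e) * ∏ F ∈ 𝓕, M.chowX F.1, M.chowMonomial_mem I 𝓕 h⟩ = 1

/-- The pairing `CH^k(M) × CH^l(M) → ℚ`, `(a, b) ↦ deg (a b)`, for `k + l = d`. -/
def poincarePairing (M : Matroid α) [M.Finite] (deg : M.chowGr M.natRank →ₗ[ℚ] ℚ) {k l : ℕ}
    (h : k + l = M.natRank) (a : M.chowGr k) (b : M.chowGr l) : ℚ :=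
  deg ⟨a.1 * b.1, M.chowGr_mul_mem h a.2 b.2⟩

/-! ### The deletion homomorphism -/

theorem IsFlat.delete {M : Matroid α} (i : α) {G : Set α} (hG : M.IsFlat G) : (M ＼ {i}).IsFlat (G \ {i}) := by
  rw [isFlat_iff_closure_eq, delete_closure_eq, sdiff_idem]
  refine subset_antisymm (sdiff_subset_sdiff_left ?_) fun x hx ↦ ⟨?_, hx.2⟩
  · exact (M.closure_subset_closure sdiff_subset).trans hG.closure.subset
  · exact M.subset_closure _ (sdiff_subset.trans hG.subset_ground) hx

theorem ProperFlat.notMem {M : Matroid α} {i : α} (F : (M ＼ {i}).ProperFlat) : i ∉ F.1 := fun h ↦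
  (F.2.1.subset_ground h).2 rfl

section Theta

variable (M : Matroid α) [M.Finite] (i : α)

theorem chowX_eq (F : M.ProperFlat) : M.chowX F.1 = M.chowMk (X (Sum.inr F)) := by
  rw [chowX, dif_pos F.2]
  rfl

theorem chowX_of_not {S : Set α} (h : ¬ (M.IsFlat S ∧ S ≠ M.E)) : M.chowX S = 0 := by
  rw [chowX, dif_neg h]

theorem chowMk_eq_zero {p : M.ChowPoly} (h : p ∈ M.linearIdeal ⊔ M.quadraticIdeal) :
    M.chowMk p = 0 :=
  Ideal.Quotient.eq_zero_iff_mem.mpr h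

theorem chowX_mul_chowX {S T : Set α} (h₁ : ¬ S ⊆ T) (h₂ : ¬ T ⊆ S) :
    M.chowX S * M.chowX T = 0 := by
  by_cases hS : M.IsFlat S ∧ S ≠ M.E
  · by_cases hT : M.IsFlat T ∧ T ≠ M.E
    · rw [M.chowX_eq ⟨S, hS⟩, M.chowX_eq ⟨T, hT⟩, ← map_mul]
      exact M.chowMk_eq_zero (Ideal.mem_sup_right (Ideal.subset_span
        (Or.inl ⟨⟨S, hS⟩, ⟨T, hT⟩, h₁, h₂, rfl⟩)))
    · rw [M.chowX_of_not hT, mul_zero]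
  · rw [M.chowX_of_not hS, zero_mul]

theorem chowY_mul_chowX (e : ↥M.E) {S : Set α} (h : e.1 ∉ S) : M.chowY e * M.chowX S = 0 := by
  by_cases hS : M.IsFlat S ∧ S ≠ M.E
  · rw [M.chowX_eq ⟨S, hS⟩, chowY, ← map_mul]
    exact M.chowMk_eq_zero (Ideal.mem_sup_right (Ideal.subset_span
      (Or.inr ⟨e, ⟨S, hS⟩, h, rfl⟩)))
  · rw [M.chowX_of_not hS, mul_zero]

open scoped Classical in
theorem chowY_eq_sum (e : ↥M.E) :
    M.chowY e = ∑ F : M.ProperFlat with e.1 ∉ F.1, M.chowX F.1 := by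
  have h := M.chowMk_eq_zero (Ideal.mem_sup_left (Ideal.subset_span ⟨e, rfl⟩))
  rw [map_sub, sub_eq_zero, map_sum] at h
  simpa only [chowX_eq, chowY] using h

/-- The images of the variables under the deletion homomorphism:
`y_e ↦ y_e` and `x_F ↦ x_F + x_{F ∪ i}`. -/
def thetaVar : ↥(M ＼ {i}).E ⊕ (M ＼ {i}).ProperFlat → M.AugChow :=
  Sum.elim (fun e ↦ M.chowY ⟨e.1, e.2.1⟩) (fun F ↦ M.chowX F.1 + M.chowX (insert i F.1))

open scoped Classical in
theorem thetaVar_linear (e : ↥(M ＼ {i}).E) :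
    M.chowY ⟨e.1, e.2.1⟩ =
      ∑ F : (M ＼ {i}).ProperFlat with e.1 ∉ F.1, (M.chowX F.1 + M.chowX (insert i F.1)) := by
  have hei : e.1 ≠ i := e.2.2
  rw [chowY_eq_sum]
  have hf (G : M.ProperFlat) (hG : e.1 ∉ G.1) :
      (M ＼ {i}).IsFlat (G.1 \ {i}) ∧ G.1 \ {i} ≠ (M ＼ {i}).E :=
    ⟨IsFlat.delete i G.2.1, fun h ↦ hG (h.symm.subset e.2).1⟩
  have hx (S : Set α) (h : M.chowX S ≠ 0) : M.IsFlat S ∧ S ≠ M.E := by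
    by_contra h'
    exact h (M.chowX_of_not h')
  rw [Finset.sum_add_distrib,
    ← Finset.sum_filter_add_sum_filter_not _ (fun G : M.ProperFlat ↦ i ∉ G.1)]
  congr 1
  · refine Finset.sum_bij_ne_zero (fun G hG _ ↦ ⟨G.1 \ {i}, hf G (Finset.mem_filter.1 (Finset.mem_filter.1 hG).1).2⟩) ?_ ?_ ?_ ?_
    · intro G hG _
      have hG' := (Finset.mem_filter.1 (Finset.mem_filter.1 hG).1).2
      exact Finset.mem_filter.2 ⟨Finset.mem_univ _, fun h ↦ hG' h.1⟩
    · intro G hG _ G' hG' _ h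
      have h' := congrArg Subtype.val h
      simp only [Finset.mem_filter, Finset.mem_univ, true_and] at hG hG'
      simp only [sdiff_singleton_eq_self hG.2, sdiff_singleton_eq_self hG'.2] at h'
      exact Subtype.ext h'
    · intro F hF hne
      simp only [Finset.mem_filter, Finset.mem_univ, true_and] at hF
      refine ⟨⟨F.1, hx _ hne⟩, ?_, hne, Subtype.ext (sdiff_singleton_eq_self F.notMem)⟩
      exact Finset.mem_filter.2 ⟨Finset.mem_filter.2 ⟨Finset.mem_univ _, hF⟩, F.notMem⟩
    · intro G hG _
      simp only [Finset.mem_filter, Finset.mem_univ, true_and] at hG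
      simp only [sdiff_singleton_eq_self hG.2]
  · refine Finset.sum_bij_ne_zero (fun G hG _ ↦ ⟨G.1 \ {i}, hf G (Finset.mem_filter.1 (Finset.mem_filter.1 hG).1).2⟩) ?_ ?_ ?_ ?_
    · intro G hG _
      have hG' := (Finset.mem_filter.1 (Finset.mem_filter.1 hG).1).2
      exact Finset.mem_filter.2 ⟨Finset.mem_univ _, fun h ↦ hG' h.1⟩
    · intro G hG _ G' hG' _ h
      have h' := congrArg Subtype.val h
      simp only [Finset.mem_filter, Finset.mem_univ, true_and, not_not] at hG hG'
      refine Subtype.ext ?_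
      rw [← insert_sdiff_self_of_mem hG.2, ← insert_sdiff_self_of_mem hG'.2]
      exact congrArg (insert i) h'
    · intro F hF hne
      simp only [Finset.mem_filter, Finset.mem_univ, true_and] at hF
      refine ⟨⟨insert i F.1, hx _ hne⟩, ?_, hne, Subtype.ext (insert_sdiff_self_of_notMem F.notMem)⟩
      exact Finset.mem_filter.2 ⟨Finset.mem_filter.2 ⟨Finset.mem_univ _, fun h ↦
        h.elim hei hF⟩, not_not.2 (mem_insert i _)⟩
    · intro G hG _
      simp only [Finset.mem_filter, Finset.mem_univ, true_and, not_not] at hG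
      simp only [insert_sdiff_self_of_mem hG.2]

theorem thetaVar_relations (p : (M ＼ {i}).ChowPoly)
    (hp : p ∈ (M ＼ {i}).linearIdeal + (M ＼ {i}).quadraticIdeal) :
    aeval (M.thetaVar i) p = 0 := by
  suffices h : (M ＼ {i}).linearIdeal + (M ＼ {i}).quadraticIdeal ≤
      RingHom.ker (aeval (R := ℚ) (M.thetaVar i)) from h hp
  refine sup_le (Ideal.span_le.2 ?_) (Ideal.span_le.2 ?_)
  · rintro _ ⟨e, rfl⟩
    simp only [SetLike.mem_coe, RingHom.mem_ker, map_sub, map_sum, aeval_X, thetaVar, Sum.elim_inl,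
      Sum.elim_inr]
    rw [sub_eq_zero]
    exact M.thetaVar_linear i e
  · rintro _ (⟨F₁, F₂, h₁, h₂, rfl⟩ | ⟨e, F, h, rfl⟩)
    · have h1 := F₁.notMem
      have h2 := F₂.notMem
      have key {S T : Set α} (hS : i ∉ S) (hST : ¬ S ⊆ T) : ¬ S ⊆ insert i T := fun h ↦
        hST ((subset_insert_iff_of_notMem hS).1 h)
      simp only [SetLike.mem_coe, RingHom.mem_ker, map_mul, aeval_X, thetaVar, Sum.elim_inr]
      rw [add_mul, mul_add, mul_add, M.chowX_mul_chowX h₁ h₂,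
        M.chowX_mul_chowX (key h1 h₁) fun h ↦ h1 (h (mem_insert i _)),
        M.chowX_mul_chowX (fun h ↦ h2 (h (mem_insert i _))) (key h2 h₂),
        M.chowX_mul_chowX (fun h ↦ key h1 h₁ ((subset_insert i _).trans h))
          (fun h ↦ key h2 h₂ ((subset_insert i _).trans h))]
      simp
    · have hei : e.1 ≠ i := e.2.2
      simp only [SetLike.mem_coe, RingHom.mem_ker, map_mul, aeval_X, thetaVar, Sum.elim_inl,
        Sum.elim_inr]
      rw [mul_add, M.chowY_mul_chowX _ h, M.chowY_mul_chowX _ (by simp [hei, h]), add_zero]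

/-- The homomorphism `θ_i : CH(M ＼ i) → CH(M)`, `x_F ↦ x_F + x_{F ∪ i}`. -/
def theta : (M ＼ {i}).AugChow →ₐ[ℚ] M.AugChow :=
  Ideal.Quotient.liftₐ _ (aeval (M.thetaVar i)) (M.thetaVar_relations i)

/-- `CH(M)` is an algebra, hence a module, over `CH(M ＼ i)` through `θ_i`. -/
instance : Algebra (M ＼ {i}).AugChow M.AugChow := (M.theta i).toRingHom.toAlgebra

/-- `CH_(i)`, the image of `θ_i`, as a `CH(M ＼ i)`-submodule of `CH(M)`. -/
def chowImage : Submodule (M ＼ {i}).AugChow M.AugChow :=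
  LinearMap.range (Algebra.linearMap (M ＼ {i}).AugChow M.AugChow)

/-- The submodule `a · CH_(i)` of `CH(M)`. -/
def mulChowImage (a : M.AugChow) : Submodule (M ＼ {i}).AugChow M.AugChow :=
  (M.chowImage i).map (LinearMap.mulLeft (M ＼ {i}).AugChow a)

/-- The collection `𝒮_i` of proper subsets `F` of `E ∖ i` such that `F` and `F ∪ i` are flats. -/
def deletionFlats (M : Matroid α) (i : α) : Set (Set α) :=
  {F | F ⊂ M.E \ {i} ∧ M.IsFlat F ∧ M.IsFlat (insert i F)}

/-- The summands in the non-coloop case: `CH_(i)`, then `x_{F ∪ i} CH_(i)` for `F ∈ 𝒮_i`. -/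
def summand : Unit ⊕ ↥(M.deletionFlats i) → Submodule (M ＼ {i}).AugChow M.AugChow :=
  Sum.elim (fun _ ↦ M.chowImage i) (fun F ↦ M.mulChowImage i (M.chowX (insert i F.1)))

/-- The summands in the coloop case: `CH_(i)` and `x_{E ∖ i} CH_(i)`, then `x_{F ∪ i} CH_(i)`
for `F ∈ 𝒮_i`. -/
def summandColoop : Fin 2 ⊕ ↥(M.deletionFlats i) → Submodule (M ＼ {i}).AugChow M.AugChow :=
  Sum.elim ![M.chowImage i, M.mulChowImage i (M.chowX (M.E \ {i}))]
    (fun F ↦ M.mulChowImage i (M.chowX (insert i F.1)))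

variable {M} {i}

/-- `N` is a graded submodule: it contains the homogeneous components of its elements. -/
def IsGradedSubmodule (N : Submodule (M ＼ {i}).AugChow M.AugChow) : Prop :=
  ∀ z ∈ N, ∃ c : ℕ →₀ M.AugChow, (∀ k, c k ∈ M.chowGr k ∧ c k ∈ N) ∧ c.sum (fun _ a ↦ a) = z

/-- `N` and `N'` are orthogonal for the Poincaré pairing defined by `deg`. -/
def PoincareOrthogonal (deg : M.chowGr M.natRank →ₗ[ℚ] ℚ)
    (N N' : Submodule (M ＼ {i}).AugChow M.AugChow) : Prop :=
  ∀ (k l : ℕ) (h : k + l = M.natRank) (a : M.chowGr k) (b : M.chowGr l),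
    a.1 ∈ N → b.1 ∈ N' → M.poincarePairing deg h a b = 0

end Theta

/-- A submodule `N` is indecomposable: it is nonzero, and it is not the direct sum of two nonzero
submodules. (The submodules need not be graded, so for a graded `N` this includes
indecomposability as a graded module.) -/
def IsIndecomposableSubmodule {R A : Type*} [CommRing R] [AddCommGroup A] [Module R A]
    (N : Submodule R A) : Prop :=
  N ≠ ⊥ ∧ ∀ N₁ N₂ : Submodule R A, Disjoint N₁ N₂ → N₁ ⊔ N₂ = N → N₁ = ⊥ ∨ N₂ = ⊥

end Matroid

end

/-!
Write `h_S` for the sum of the `x_F` over the proper flats `F` with `S ⊈ F`, so that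
`y_e = h_{e}`. The augmented Chow ring is generated by the `h_F` of flats, and its degree map is
given by a Hall–Rado condition: a product of `d` classes `h_S` has degree `1` if the union of any
`k` of the sets has rank at least `k`, and degree `0` otherwise. Taking this condition as the
definition of a functional on the polynomial ring in the `h_S` and dividing by the largest ideal in
its kernel produces a Poincaré duality ring, to which `CH(M)` maps; this gives the degree map.

The products of the `h_F` over chains of flats with bounded multiplicities span `CH(M)`, and each of
them has a test class that pairs to `1` with it and to `0` with the standard products of smaller
rank sum. Hence the extended degree functional is nondegenerate on `CH(M)`.

As `θ_i (h_S) = h_S`, the degree formula also computes the pairing between the generators `1`,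
`x_{E ∖ i}`, `x_{F ∪ i}` of the summands. The summands span `CH(M)` since the `x_G` and the products
of two generators lie in their sum; by Poincaré duality an element of two orthogonal summands is
orthogonal to everything, so the sum is direct. Finally, each summand is cyclic over the local ring
`CH(M ＼ i)`, hence indecomposable.
-/

noncomputable section

namespace AugmentedChow

open Matroid Set MvPolynomial

variable {α : Type*}

/-- The rank of a set in a matroid of finite rank, as a natural number. -/
def natRk (M : Matroid α) (S : Set α) : ℕ := (M.eRk S).toNat

section Rank

variable {M : Matroid α} {F G S T : Set α} {e : α}

lemma isFlat_inter (hF : M.IsFlat F) (hG : M.IsFlat G) : M.IsFlat (F ∩ G) := by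
  rw [inter_eq_iInter]
  exact IsFlat.iInter (Bool.rec hG hF)

lemma isFlat_empty (M : Matroid α) [M.Loopless] : M.IsFlat ∅ := by
  rw [isFlat_iff_closure_eq, closure_empty, loops_eq_empty]

lemma closure_subset_iff (hF : M.IsFlat F) (hS : S ⊆ M.E) : M.closure S ⊆ F ↔ S ⊆ F :=
  ⟨(M.subset_closure S).trans, fun h ↦ (M.closure_subset_closure h).trans hF.closure.subset⟩

lemma natRk_closure (M : Matroid α) (S : Set α) : natRk M (M.closure S) = natRk M S := by
  rw [natRk, eRk_closure_eq, natRk]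

lemma natRk_empty (M : Matroid α) : natRk M ∅ = 0 := by simp [natRk]

lemma natRk_ground (M : Matroid α) : natRk M M.E = M.natRank := by
  rw [natRk, eRk_ground, natRank]

lemma natRk_of_indep (h : M.Indep S) : natRk M S = S.ncard := by
  rw [natRk, h.eRk_eq_encard, ncard]

variable [M.RankFinite]

lemma coe_natRk (M : Matroid α) [M.RankFinite] (S : Set α) : (natRk M S : ℕ∞) = M.eRk S :=
  ENat.natCast_toNat (eRk_ne_top_iff.2 (M.isRkFinite_set S))

lemma natRk_mono (M : Matroid α) [M.RankFinite] (h : S ⊆ T) : natRk M S ≤ natRk M T := by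
  have := M.eRk_mono h
  rw [← coe_natRk, ← coe_natRk] at this
  exact_mod_cast this

lemma natRk_le_natRank (M : Matroid α) [M.RankFinite] (S : Set α) : natRk M S ≤ M.natRank := by
  have := M.eRk_le_eRank S
  rw [← eRk_ground, ← coe_natRk, ← coe_natRk, natRk_ground] at this
  exact_mod_cast this

lemma natRk_inter_add_union_le (M : Matroid α) [M.RankFinite] (S T : Set α) :
    natRk M (S ∩ T) + natRk M (S ∪ T) ≤ natRk M S + natRk M T := by
  have := M.eRk_inter_add_eRk_union_le S T
  simp only [← coe_natRk] at this
  exact_mod_cast this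

lemma natRk_insert_le (M : Matroid α) [M.RankFinite] (e : α) (S : Set α) :
    natRk M (insert e S) ≤ natRk M S + 1 := by
  have := M.eRk_insert_le_add_one e S
  simp only [← coe_natRk] at this
  exact_mod_cast this

lemma natRk_lt_of_ssubset (hF : M.IsFlat F) (h : F ⊂ G) (hG : G ⊆ M.E) :
    natRk M F < natRk M G := by
  refine (natRk_mono M h.subset).lt_of_ne fun heq ↦ h.not_subset ?_
  have hcl : M.closure F = M.closure G :=
    (M.isRkFinite_set F).closure_eq_closure_of_subset_of_eRk_ge_eRk h.subset
      (by rw [← coe_natRk M F, heq, coe_natRk])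
  exact (M.subset_closure G).trans (hcl.symm.trans hF.closure).subset

lemma eq_of_subset_of_natRk_le (hF : M.IsFlat F) (h : F ⊆ G) (hG : G ⊆ M.E)
    (hr : natRk M G ≤ natRk M F) : F = G := by
  by_contra hne
  exact absurd (natRk_lt_of_ssubset hF (h.ssubset_of_ne hne) hG) (not_lt.2 hr)

lemma natRk_insert (hF : M.IsFlat F) (he : e ∉ F) (heE : e ∈ M.E) :
    natRk M (insert e F) = natRk M F + 1 :=
  le_antisymm (natRk_insert_le M e F)
    (natRk_lt_of_ssubset hF (ssubset_insert he) (insert_subset heE hF.subset_ground))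

lemma natRk_union_le_of_mem {H : Set α} (hF : M.IsFlat F) (hFH : F ⊆ H) (heH : e ∈ H)
    (heG : e ∈ G) (heF : e ∉ F) (hG : G ⊆ M.E) {n : ℕ}
    (h : natRk M (F ∪ G) ≤ natRk M F + (n + 1)) : natRk M (H ∪ G) ≤ natRk M H + n := by
  have hsub := natRk_inter_add_union_le M (F ∪ G) H
  have hins : natRk M (insert e F) ≤ natRk M ((F ∪ G) ∩ H) :=
    natRk_mono M (insert_subset ⟨Or.inr heG, heH⟩ fun x hx ↦ ⟨Or.inl hx, hFH hx⟩)
  rw [natRk_insert hF heF (hG heG)] at hins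
  rw [union_right_comm, union_eq_self_of_subset_left hFH] at hsub
  omega

end Rank

open Classical in
/-- The number of members of the multiset `s` that are contained in `K`. -/
def subsetCount (s : Multiset (Set α)) (K : Set α) : ℕ := s.countP (· ⊆ K)

/-- The Hall–Rado condition: `s` has as many members as the rank of `M`, and at most `rk G` of them
are contained in `G`, for every flat `G`. The degree of a monomial in the classes `h_S` is `1` if
this condition holds, and `0` otherwise. -/
structure HallRado (M : Matroid α) (s : Multiset (Set α)) : Prop where
  card_eq : s.card = M.natRank
  subsetCount_le : ∀ G, M.IsFlat G → subsetCount s G ≤ natRk M G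

/-- The polynomial ring over `ℚ` in variables `h_S` for all sets `S`; its monomials are encoded as
multisets of sets. -/
abbrev SetPoly (α : Type*) := AddMonoidAlgebra ℚ (Multiset (Set α))

/-- The variable `h_S`. -/
def setVar (S : Set α) : SetPoly α := AddMonoidAlgebra.single {S} 1

open Classical in
/-- The linear functional that takes the value `1` on the monomials satisfying the Hall–Rado
condition, and `0` on all others. -/
def hallRadoFun (M : Matroid α) : SetPoly α →ₗ[ℚ] ℚ :=
  (Finsupp.linearCombination ℚ fun s ↦ if HallRado M s then (1 : ℚ) else 0) ∘ₗ
    (AddMonoidAlgebra.coeffLinearEquiv (S := ℚ) ℚ).toLinearMap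

/-- The largest ideal on which the Hall–Rado functional vanishes. -/
def hallRadoIdeal (M : Matroid α) : Ideal (SetPoly α) where
  carrier := {p | ∀ q, hallRadoFun M (p * q) = 0}
  add_mem' ha hb q := by rw [add_mul, map_add, ha, hb, add_zero]
  zero_mem' q := by rw [zero_mul, map_zero]
  smul_mem' c x hx q := by
    rw [smul_eq_mul, mul_comm c, mul_assoc]
    exact hx _

section SubsetCount

variable {M : Matroid α} {S T K N : Set α}

open Classical in
lemma subsetCount_singleton (S K : Set α) : subsetCount {S} K = if S ⊆ K then 1 else 0 := by
  rw [subsetCount, ← Multiset.cons_zero, Multiset.countP_cons, Multiset.countP_zero, zero_add]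

lemma subsetCount_singleton_le_one (S K : Set α) : subsetCount {S} K ≤ 1 := by
  rw [subsetCount_singleton]
  split_ifs <;> simp

lemma subsetCount_singleton_eq_one : subsetCount {S} K = 1 ↔ S ⊆ K := by
  simp [subsetCount_singleton]

lemma subsetCount_cons (s : Multiset (Set α)) (S K : Set α) :
    subsetCount (S ::ₘ s) K = subsetCount s K + subsetCount {S} K := by
  rw [subsetCount_singleton, subsetCount, Multiset.countP_cons, subsetCount]

lemma subsetCount_mono (s : Multiset (Set α)) (hK : K ⊆ N) :
    subsetCount s K ≤ subsetCount s N := by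
  classical
  rw [subsetCount, subsetCount, Multiset.countP_eq_card_filter, Multiset.countP_eq_card_filter]
  exact Multiset.card_le_card (Multiset.monotone_filter_right s fun S h ↦ h.trans hK)

lemma subsetCount_singleton_closure (hK : M.IsFlat K) (hS : S ⊆ M.E) :
    subsetCount {M.closure S} K = subsetCount {S} K := by
  rw [subsetCount_singleton, subsetCount_singleton, closure_subset_iff hK hS]

lemma subsetCount_singleton_union (S T K : Set α) :
    subsetCount {S ∪ T} K = min (subsetCount {S} K) (subsetCount {T} K) := by
  simp only [subsetCount_singleton, union_subset_iff]
  split_ifs <;> simp_all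

lemma subsetCount_singleton_inter (S K L : Set α) :
    subsetCount {S} (K ∩ L) = min (subsetCount {S} K) (subsetCount {S} L) := by
  simp only [subsetCount_singleton, subset_inter_iff]
  split_ifs <;> simp_all

lemma subsetCount_add_le (s : Multiset (Set α)) {K L : Set α} (hK : K ⊆ N) (hL : L ⊆ N) :
    subsetCount s K + subsetCount s L ≤ subsetCount s N + subsetCount s (K ∩ L) := by
  induction s using Multiset.induction with
  | empty => simp [subsetCount]
  | cons S s ih =>
    have hSK := subsetCount_mono {S} hK
    have hSL := subsetCount_mono {S} hL
    simp only [subsetCount_cons, subsetCount_singleton_inter]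
    omega

/-- Submodularity of the rank makes the tight flats of a multiset closed under joins. -/
lemma natRk_closure_union_le_subsetCount [M.RankFinite] {s : Multiset (Set α)} {K L : Set α}
    (hs : ∀ G, M.IsFlat G → subsetCount s G ≤ natRk M G) (hK : M.IsFlat K) (hL : M.IsFlat L)
    (hK' : natRk M K ≤ subsetCount s K) (hL' : natRk M L ≤ subsetCount s L) :
    natRk M (M.closure (K ∪ L)) ≤ subsetCount s (M.closure (K ∪ L)) := by
  have hE := M.subset_closure (K ∪ L) (union_subset hK.subset_ground hL.subset_ground)
  have hcount := subsetCount_add_le s (subset_union_left.trans hE) (subset_union_right.trans hE)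
  have hinter := hs _ (isFlat_inter hK hL)
  have hrank := natRk_inter_add_union_le M K L
  rw [natRk_closure]
  omega

end SubsetCount

section HallRado

variable {M : Matroid α} {A B A' B' F G H : Set α} {e : α} {s : Multiset (Set α)}

open Classical in
lemma hallRadoFun_single (M : Matroid α) (s : Multiset (Set α)) :
    hallRadoFun M (AddMonoidAlgebra.single s 1) = if HallRado M s then 1 else 0 := by
  simp [hallRadoFun]

lemma mem_hallRadoIdeal_of_single {p : SetPoly α}
    (h : ∀ s, hallRadoFun M (p * AddMonoidAlgebra.single s 1) = 0) : p ∈ hallRadoIdeal M := by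
  intro q
  induction q using AddMonoidAlgebra.induction_linear with
  | zero => simp
  | add f g hf hg => rw [mul_add, map_add, hf, hg, add_zero]
  | single s c =>
    have : (AddMonoidAlgebra.single s c : SetPoly α) = c • AddMonoidAlgebra.single s 1 := by simp
    rw [this, mul_smul_comm, map_smul, h, smul_zero]

lemma setVar_empty_mem_hallRadoIdeal (M : Matroid α) [M.Loopless] :
    setVar ∅ ∈ hallRadoIdeal M := by
  refine mem_hallRadoIdeal_of_single fun s ↦ ?_
  rw [setVar, AddMonoidAlgebra.single_mul_single, mul_one, hallRadoFun_single, if_neg]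
  intro h
  have := h.subsetCount_le ∅ (isFlat_empty M)
  rw [Multiset.singleton_add, subsetCount_cons, natRk_empty,
    subsetCount_singleton_eq_one.2 subset_rfl] at this
  omega

lemma hallRado_cons_cons : HallRado M (A ::ₘ B ::ₘ s) ↔ s.card + 2 = M.natRank ∧
    ∀ K, M.IsFlat K → subsetCount s K + subsetCount {B} K + subsetCount {A} K ≤ natRk M K :=
  ⟨fun ⟨hc, h⟩ ↦ by simpa only [Multiset.card_cons, subsetCount_cons] using And.intro hc h,
    fun ⟨hc, h⟩ ↦ ⟨by simpa only [Multiset.card_cons] using hc,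
      by simpa only [subsetCount_cons] using h⟩⟩

lemma HallRado.cons_cons_of_le (h : HallRado M (A ::ₘ B ::ₘ s))
    (hle : ∀ K, M.IsFlat K →
      subsetCount {B'} K + subsetCount {A'} K ≤ subsetCount {B} K + subsetCount {A} K) :
    HallRado M (A' ::ₘ B' ::ₘ s) := by
  rw [hallRado_cons_cons] at h ⊢
  refine ⟨h.1, fun K hK ↦ ?_⟩
  have := h.2 K hK
  have := hle K hK
  omega

lemma setVar_mul_setVar_mul_single (A B : Set α) (s : Multiset (Set α)) :
    setVar A * setVar B * AddMonoidAlgebra.single s 1 =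
      (AddMonoidAlgebra.single (A ::ₘ B ::ₘ s) 1 : SetPoly α) := by
  simp [setVar, AddMonoidAlgebra.single_mul_single]

lemma subsetCount_singleton_closure_union (hF : F ⊆ M.E) (hG : G ⊆ M.E) {K : Set α}
    (hK : M.IsFlat K) :
    subsetCount {M.closure (F ∪ G)} K = min (subsetCount {F} K) (subsetCount {G} K) := by
  rw [subsetCount_singleton_closure hK (union_subset hF hG), subsetCount_singleton_union]

variable [M.RankFinite]

/-- If both conclusions failed, at the flats `K` and `L` say, then `K` and `L` would be tight for
`s`, hence so would be their join, which contains `F ∪ G`. -/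
lemma HallRado.left_or_right_of_closure_union (hF : F ⊆ M.E) (hG : G ⊆ M.E)
    (hH : H = M.closure (F ∪ G)) (h : HallRado M (H ::ₘ H ::ₘ s)) :
    HallRado M (F ::ₘ H ::ₘ s) ∨ HallRado M (H ::ₘ G ::ₘ s) := by
  simp only [hallRado_cons_cons] at h ⊢
  obtain ⟨hd, h⟩ := h
  by_contra! hcon
  obtain ⟨K, hK, hFK⟩ := hcon.1 hd
  obtain ⟨L, hL, hGL⟩ := hcon.2 hd
  have hcount {N : Set α} (hN : M.IsFlat N) : subsetCount {H} N ≤ 1 ∧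
      subsetCount {F} N ≤ 1 ∧ subsetCount {G} N ≤ 1 ∧
      subsetCount {H} N = min (subsetCount {F} N) (subsetCount {G} N) :=
    ⟨subsetCount_singleton_le_one _ _, subsetCount_singleton_le_one _ _,
      subsetCount_singleton_le_one _ _, by
        rw [hH, subsetCount_singleton_closure_union hF hG hN]⟩
  have hKcount := hcount hK
  have hLcount := hcount hL
  have hKle := h K hK
  have hLle := h L hL
  have hsub : F ∪ G ⊆ K ∪ L := union_subset_union
    (subsetCount_singleton_eq_one.1 (by omega)) (subsetCount_singleton_eq_one.1 (by omega))
  have htight := natRk_closure_union_le_subsetCount (s := s)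
    (fun N hN ↦ le_trans (by omega) (h N hN)) hK hL (by omega) (by omega)
  have hHle := h _ (M.isFlat_closure (K ∪ L))
  have hHcount : subsetCount {H} (M.closure (K ∪ L)) = 1 :=
    subsetCount_singleton_eq_one.2 (hH.subset.trans (M.closure_subset_closure hsub))
  omega

lemma closure_union_sub_mul_sub_mem_hallRadoIdeal (hF : F ⊆ M.E) (hG : G ⊆ M.E) :
    (setVar (M.closure (F ∪ G)) - setVar F) * (setVar (M.closure (F ∪ G)) - setVar G)
      ∈ hallRadoIdeal M := by
  refine mem_hallRadoIdeal_of_single fun s ↦ ?_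
  set H := M.closure (F ∪ G) with hH
  have hmin {K : Set α} (hK : M.IsFlat K) :
      subsetCount {H} K = min (subsetCount {F} K) (subsetCount {G} K) :=
    subsetCount_singleton_closure_union hF hG hK
  have hFG_FH (h : HallRado M (F ::ₘ G ::ₘ s)) : HallRado M (F ::ₘ H ::ₘ s) :=
    h.cons_cons_of_le fun K hK ↦ by have := hmin hK; omega
  have hFG_HG (h : HallRado M (F ::ₘ G ::ₘ s)) : HallRado M (H ::ₘ G ::ₘ s) :=
    h.cons_cons_of_le fun K hK ↦ by have := hmin hK; omega
  have hFH_HH (h : HallRado M (F ::ₘ H ::ₘ s)) : HallRado M (H ::ₘ H ::ₘ s) :=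
    h.cons_cons_of_le fun K hK ↦ by have := hmin hK; omega
  have hHG_HH (h : HallRado M (H ::ₘ G ::ₘ s)) : HallRado M (H ::ₘ H ::ₘ s) :=
    h.cons_cons_of_le fun K hK ↦ by have := hmin hK; omega
  have hFG (h : HallRado M (F ::ₘ H ::ₘ s)) (h' : HallRado M (H ::ₘ G ::ₘ s)) :
      HallRado M (F ::ₘ G ::ₘ s) := by
    rw [hallRado_cons_cons] at h h' ⊢
    refine ⟨h.1, fun K hK ↦ ?_⟩
    have := h.2 K hK
    have := h'.2 K hK
    have := hmin hK
    omega
  have hHH := HallRado.left_or_right_of_closure_union hF hG hH (s := s)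
  simp only [sub_mul, mul_sub, setVar_mul_setVar_mul_single, map_sub, hallRadoFun_single]
  split_ifs <;> first | norm_num; done | tauto

/-- If `h_F` fails the condition at a flat `K`, then so does `h_e h_F` at the closure of `K ∪ e`. -/
lemma hallRado_closure_singleton_cons_iff (hF : F ⊆ M.E) (he : e ∈ M.E) :
    HallRado M (M.closure {e} ::ₘ M.closure (insert e F) ::ₘ s) ↔
      HallRado M (M.closure {e} ::ₘ F ::ₘ s) := by
  have hmin {K : Set α} (hK : M.IsFlat K) : subsetCount {M.closure (insert e F)} K =
      min (subsetCount {M.closure {e}} K) (subsetCount {F} K) := by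
    rw [← singleton_union, subsetCount_singleton_closure_union (singleton_subset_iff.2 he) hF hK,
      subsetCount_singleton_closure hK (singleton_subset_iff.2 he)]
  refine ⟨fun h ↦ ?_, fun h ↦ h.cons_cons_of_le fun K hK ↦ by have := hmin hK; omega⟩
  rw [hallRado_cons_cons] at h ⊢
  refine ⟨h.1, fun K hK ↦ ?_⟩
  have hKE : insert e K ⊆ M.closure (insert e K) :=
    M.subset_closure _ (insert_subset he hK.subset_ground)
  have hcl := M.isFlat_closure (insert e K)
  have hK_le := h.2 K hK
  have hcl_le := h.2 _ hcl
  rw [natRk_closure] at hcl_le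
  have hrank := natRk_insert_le M e K
  have hmono := subsetCount_mono s ((subset_insert e K).trans hKE)
  have hmonoF := subsetCount_mono {F} ((subset_insert e K).trans hKE)
  have he_one : subsetCount {M.closure {e}} (M.closure (insert e K)) = 1 :=
    subsetCount_singleton_eq_one.2 (M.closure_subset_closure (by simp))
  have hF_le := subsetCount_singleton_le_one F (M.closure (insert e K))
  have he_le := subsetCount_singleton_le_one (M.closure {e}) K
  have := hmin hK
  have := hmin hcl
  omega

lemma closure_singleton_mul_mem_hallRadoIdeal (hF : F ⊆ M.E) (he : e ∈ M.E) :
    setVar (M.closure {e}) * (setVar (M.closure (insert e F)) - setVar F)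
      ∈ hallRadoIdeal M := by
  refine mem_hallRadoIdeal_of_single fun s ↦ ?_
  have hiff := hallRado_closure_singleton_cons_iff (s := s) hF he
  simp only [sub_mul, mul_sub, setVar_mul_setVar_mul_single, map_sub, hallRadoFun_single]
  split_ifs <;> simp_all

end HallRado

/-- The quotient of the polynomial ring in the `h_S` by the largest ideal on which the Hall–Rado
functional vanishes. It receives a homomorphism from `CH(M)` that sends `h_F` to `h_F`, along which
the functional is pulled back to the degree. -/
abbrev HallRing (M : Matroid α) := SetPoly α ⧸ hallRadoIdeal M

/-- The class of the variable `h_S` in `HallRing M`. -/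
def hallH (M : Matroid α) (S : Set α) : HallRing M := Ideal.Quotient.mk _ (setVar S)

section HallRing

variable {M : Matroid α} {F G S T : Set α} {e : α}

lemma hallH_empty (M : Matroid α) [M.Loopless] : hallH M ∅ = 0 :=
  Ideal.Quotient.eq_zero_iff_mem.2 (setVar_empty_mem_hallRadoIdeal M)

lemma hallH_closure_union_sub_mul_sub [M.RankFinite] (hF : F ⊆ M.E) (hG : G ⊆ M.E) :
    (hallH M (M.closure (F ∪ G)) - hallH M F) * (hallH M (M.closure (F ∪ G)) - hallH M G) = 0 :=
  Ideal.Quotient.eq_zero_iff_mem.2 (closure_union_sub_mul_sub_mem_hallRadoIdeal hF hG)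

lemma hallH_closure_singleton_mul_sub [M.RankFinite] (hF : F ⊆ M.E) (he : e ∈ M.E) :
    hallH M (M.closure {e}) * (hallH M (M.closure (insert e F)) - hallH M F) = 0 :=
  Ideal.Quotient.eq_zero_iff_mem.2 (closure_singleton_mul_mem_hallRadoIdeal hF he)

/-- The Hall–Rado functional on the quotient `HallRing M`. -/
def hallDeg (M : Matroid α) : HallRing M →ₗ[ℚ] ℚ :=
  (((hallRadoIdeal M).restrictScalars ℚ).liftQ (hallRadoFun M)
      fun p hp ↦ by simpa only [mul_one, LinearMap.mem_ker] using hp 1) ∘ₗ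
    (Submodule.Quotient.restrictScalarsEquiv ℚ (hallRadoIdeal M)).symm.toLinearMap

open Classical in
lemma hallDeg_prod_hallH (M : Matroid α) (s : Multiset (Set α)) :
    hallDeg M (s.map (hallH M)).prod = if HallRado M s then 1 else 0 := by
  have hprod : (s.map (hallH M)).prod = Ideal.Quotient.mk _ (AddMonoidAlgebra.single s 1) := by
    induction s using Multiset.induction with
    | empty => rfl
    | cons S s ih =>
      rw [Multiset.map_cons, Multiset.prod_cons, ih, hallH, ← map_mul, setVar,
        AddMonoidAlgebra.single_mul_single, mul_one, Multiset.singleton_add]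
  rw [hprod, ← hallRadoFun_single]
  rfl

lemma exists_sum_filter_le_eq {ι A : Type*} [Fintype ι] [PartialOrder ι] [DecidableLE ι]
    [AddCommGroup A] (f : ι → A) : ∃ g : ι → A, ∀ a, ∑ b with a ≤ b, g b = f a := by
  classical
  have wf : WellFounded fun b a : ι ↦ a < b := wellFounded_gt
  let g := wf.fix fun a g ↦ f a - ∑ b : {b // a < b}, g b.1 b.2
  have hg (a : ι) : g a = f a - ∑ b with a < b, g b := by
    rw [Finset.sum_subtype (p := (a < ·)) _ (by simp)]
    exact wf.fix_eq _ a
  refine ⟨g, fun a ↦ ?_⟩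
  have hIci : ({b | a ≤ b} : Finset ι) = insert a ({b | a < b} : Finset ι) := by
    ext b
    simp [le_iff_eq_or_lt, eq_comm]
  rw [hIci, Finset.sum_insert (by simp), hg a, sub_add_cancel]

lemma properFlat_induction [M.Finite] {P : M.ProperFlat → Prop}
    (h : ∀ F, (∀ G : M.ProperFlat, F.1 ⊂ G.1 → P G) → P F) (F : M.ProperFlat) : P F :=
  let : PartialOrder M.ProperFlat := PartialOrder.lift (fun F ↦ F.1) Subtype.val_injective
  WellFoundedGT.induction F h

variable (M) [M.Finite]

open Classical in
lemma exists_sum_superset_eq_hallH_sub : ∃ x : M.ProperFlat → HallRing M, ∀ F : M.ProperFlat,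
    ∑ G : M.ProperFlat with F.1 ⊆ G.1, x G = hallH M M.E - hallH M F.1 := by
  let : PartialOrder M.ProperFlat := PartialOrder.lift (fun F ↦ F.1) Subtype.val_injective
  exact exists_sum_filter_le_eq fun F : M.ProperFlat ↦ hallH M M.E - hallH M F.1

/-- The image of the variable `x_F` in `HallRing M`. -/
def hallX : M.ProperFlat → HallRing M := (exists_sum_superset_eq_hallH_sub M).choose

open Classical in
lemma sum_superset_hallX (hS : S ⊆ M.E) :
    ∑ G : M.ProperFlat with S ⊆ G.1, hallX M G = hallH M M.E - hallH M (M.closure S) := by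
  have hiff (G : M.ProperFlat) : M.closure S ⊆ G.1 ↔ S ⊆ G.1 := closure_subset_iff G.2.1 hS
  by_cases h : M.closure S = M.E
  · rw [h, sub_self]
    refine Finset.sum_eq_zero fun G hG ↦ absurd ?_ G.2.2
    exact G.2.1.subset_ground.antisymm
      (h.symm.subset.trans ((hiff G).2 (Finset.mem_filter.1 hG).2))
  · rw [← (exists_sum_superset_eq_hallH_sub M).choose_spec ⟨_, M.isFlat_closure S, h⟩]
    simp only [hallX, hiff]

open Classical in
lemma sum_interval_hallX (hST : S ⊆ T) (hT : T ⊆ M.E) :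
    ∑ G : M.ProperFlat with S ⊆ G.1 ∧ ¬ T ⊆ G.1, hallX M G =
      hallH M (M.closure T) - hallH M (M.closure S) := by
  have h := Finset.sum_filter_add_sum_filter_not ({G : M.ProperFlat | S ⊆ G.1} : Finset _)
    (fun G : M.ProperFlat ↦ T ⊆ G.1) (hallX M)
  rw [Finset.filter_filter, Finset.filter_filter,
    Finset.filter_congr fun G _ ↦ and_iff_right_of_imp fun h : T ⊆ G.1 ↦ hST.trans h,
    sum_superset_hallX M hT, sum_superset_hallX M (hST.trans hT)] at h
  rw [eq_sub_of_add_eq' h]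
  abel

open Classical in
lemma sum_not_superset_hallX [M.Loopless] (hS : S ⊆ M.E) :
    ∑ G : M.ProperFlat with ¬ S ⊆ G.1, hallX M G = hallH M (M.closure S) := by
  have h := sum_interval_hallX M (empty_subset S) hS
  rw [(isFlat_empty M).closure, hallH_empty, sub_zero] at h
  simpa only [empty_subset, true_and] using h

/-- Expanding `(h_{F ∨ G} - h_F) (h_{F ∨ G} - h_G) = 0` in terms of the `x_{F'}` leaves only the
term `x_F x_G`, by induction. -/
lemma hallX_mul_hallX (F : M.ProperFlat) : ∀ G : M.ProperFlat, ¬ F.1 ⊆ G.1 → ¬ G.1 ⊆ F.1 →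
    hallX M F * hallX M G = 0 := by
  classical
  induction F using properFlat_induction with
  | h F ihF =>
  intro G
  induction G using properFlat_induction with
  | h G ihG =>
  intro hFG hGF
  have hE := union_subset F.2.1.subset_ground G.2.1.subset_ground
  have hrel := hallH_closure_union_sub_mul_sub F.2.1.subset_ground G.2.1.subset_ground
  have hF := sum_interval_hallX M (subset_union_left (t := G.1)) hE
  have hG := sum_interval_hallX M (subset_union_right (s := F.1)) hE
  rw [F.2.1.closure] at hF
  rw [G.2.1.closure] at hG
  rw [← hF, ← hG, Finset.sum_mul_sum, ← Finset.sum_product'] at hrel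
  rw [← hrel, Finset.sum_eq_single (F, G) _ fun h ↦ by simp [hFG, hGF] at h]
  rintro ⟨F', G'⟩ hmem hne
  simp only [Finset.mem_product, Finset.mem_filter, Finset.mem_univ, true_and,
    union_subset_iff, not_and] at hmem
  obtain ⟨⟨hFF', hF'⟩, hGG', hG'⟩ := hmem
  by_cases hF'_eq : F' = F
  · subst hF'_eq
    have hGG'_ne : G.1 ≠ G'.1 := fun h ↦ hne (by rw [Subtype.ext h])
    exact ihG G' (hGG'.ssubset_of_ne hGG'_ne) (fun h ↦ hG' h hGG') fun h ↦ hF' hFF' (hGG'.trans h)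
  · exact ihF F' (hFF'.ssubset_of_ne fun h ↦ hF'_eq (Subtype.ext h.symm)) G'
      (fun h ↦ hG' (hFF'.trans h) hGG') fun h ↦ hF' hFF' (hGG'.trans h)

lemma hallH_closure_singleton_mul_hallX (he : e ∈ M.E) (F : M.ProperFlat) (heF : e ∉ F.1) :
    hallH M (M.closure {e}) * hallX M F = 0 := by
  classical
  induction F using properFlat_induction with
  | h F ih =>
  have hsum := sum_interval_hallX M (subset_insert e F.1) (insert_subset he F.2.1.subset_ground)
  have hrel := hallH_closure_singleton_mul_sub F.2.1.subset_ground he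
  rw [F.2.1.closure] at hsum
  rw [← hsum, Finset.mul_sum] at hrel
  rw [← hrel, Finset.sum_eq_single F _ fun h ↦ by simp [heF, insert_subset_iff] at h]
  intro G hG hne
  simp only [Finset.mem_filter, Finset.mem_univ, true_and, insert_subset_iff, not_and'] at hG
  exact ih G (hG.1.ssubset_of_ne fun h ↦ hne (Subtype.ext h.symm)) (hG.2 hG.1)

variable [M.Loopless]

/-- The images of the variables `y_e` and `x_F` in `HallRing M`. -/
def hallVar : ↥M.E ⊕ M.ProperFlat → HallRing M :=
  Sum.elim (fun e ↦ hallH M (M.closure {e.1})) (hallX M)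

lemma aeval_hallVar_eq_zero (p : M.ChowPoly) (hp : p ∈ M.linearIdeal + M.quadraticIdeal) :
    aeval (hallVar M) p = 0 := by
  classical
  suffices h : M.linearIdeal + M.quadraticIdeal ≤ RingHom.ker (aeval (R := ℚ) (hallVar M)) from h hp
  refine sup_le (Ideal.span_le.2 ?_) (Ideal.span_le.2 ?_)
  · rintro _ ⟨e, rfl⟩
    simp only [SetLike.mem_coe, RingHom.mem_ker, map_sub, map_sum, aeval_X, hallVar, Sum.elim_inl,
      Sum.elim_inr]
    rw [sub_eq_zero, ← sum_not_superset_hallX M (singleton_subset_iff.2 e.2)]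
    simp only [singleton_subset_iff]
  · rintro _ (⟨F, G, hFG, hGF, rfl⟩ | ⟨e, F, heF, rfl⟩)
    · simpa only [SetLike.mem_coe, RingHom.mem_ker, map_mul, aeval_X, hallVar, Sum.elim_inr,
        Sum.elim_inl] using
        hallX_mul_hallX M F G hFG hGF
    · simpa only [SetLike.mem_coe, RingHom.mem_ker, map_mul, aeval_X, hallVar, Sum.elim_inr,
        Sum.elim_inl] using
        hallH_closure_singleton_mul_hallX M e.2 F heF

/-- The homomorphism from `CH(M)` to `HallRing M` that fixes the classes `h_F` of flats. -/
def toHallRing : M.AugChow →ₐ[ℚ] HallRing M :=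
  Ideal.Quotient.liftₐ _ (aeval (hallVar M)) (aeval_hallVar_eq_zero M)

/-- The degree map, extended by zero to a linear functional on the whole of `CH(M)`. -/
def chowDeg : M.AugChow →ₗ[ℚ] ℚ := hallDeg M ∘ₗ (toHallRing M).toLinearMap

end HallRing

open Classical in
/-- The class `h_S`, the sum of the `x_F` over the proper flats that do not contain `S`. -/
def chowH (M : Matroid α) [M.Finite] (S : Set α) : M.AugChow :=
  ∑ F : M.ProperFlat with ¬ S ⊆ F.1, M.chowX F.1

/-- The product of the classes `h_S` over a multiset of sets. -/
def chowHProd (M : Matroid α) [M.Finite] (s : Multiset (Set α)) : M.AugChow :=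
  (s.map (chowH M)).prod

lemma toHallRing_chowX (M : Matroid α) [M.Finite] [M.Loopless] (F : M.ProperFlat) :
    toHallRing M (M.chowX F.1) = hallX M F := by
  rw [chowX_eq]
  exact aeval_X (hallVar M) (Sum.inr F)

lemma toHallRing_chowH {M : Matroid α} [M.Finite] [M.Loopless] {F : Set α} (hF : M.IsFlat F) :
    toHallRing M (chowH M F) = hallH M F := by
  simp only [chowH, map_sum, toHallRing_chowX]
  rw [sum_not_superset_hallX M hF.subset_ground, hF.closure]

open Classical in
theorem chowDeg_chowHProd {M : Matroid α} [M.Finite] [M.Loopless] {s : Multiset (Set α)}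
    (hs : ∀ F ∈ s, M.IsFlat F) : chowDeg M (chowHProd M s) = if HallRado M s then 1 else 0 := by
  rw [← hallDeg_prod_hallH, chowDeg, LinearMap.comp_apply, AlgHom.toLinearMap_apply, chowHProd,
    map_multiset_prod, Multiset.map_map]
  exact congrArg _ (congrArg _ (Multiset.map_congr rfl fun F hF ↦ toHallRing_chowH (hs F hF)))

section ChowH

variable {M : Matroid α} [M.Finite] {F G S T : Set α} {e : α} {n : ℕ}

open Classical in
lemma chowH_sub (M : Matroid α) [M.Finite] (hST : S ⊆ T) :
    chowH M T - chowH M S = ∑ H : M.ProperFlat with S ⊆ H.1 ∧ ¬ T ⊆ H.1, M.chowX H.1 := by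
  have h := Finset.sum_filter_add_sum_filter_not ({H : M.ProperFlat | ¬ T ⊆ H.1} : Finset _)
    (fun H : M.ProperFlat ↦ S ⊆ H.1) (fun H ↦ M.chowX H.1)
  rw [Finset.filter_filter, Finset.filter_filter,
    Finset.filter_congr fun (H : M.ProperFlat) _ ↦ and_comm (a := ¬ T ⊆ H.1) (b := S ⊆ H.1),
    Finset.filter_congr fun (H : M.ProperFlat) _ ↦
      and_iff_right_of_imp fun h : ¬ S ⊆ H.1 ↦ mt hST.trans h] at h
  exact sub_eq_of_eq_add h.symm

lemma chowH_empty (M : Matroid α) [M.Finite] : chowH M ∅ = 0 := by simp [chowH]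

lemma chowH_singleton (e : ↥M.E) : chowH M {e.1} = M.chowY e := by
  classical
  rw [chowH, chowY_eq_sum]
  exact Finset.sum_congr (Finset.filter_congr fun F _ ↦ not_congr singleton_subset_iff)
    fun _ _ ↦ rfl

lemma chowH_closure (hS : S ⊆ M.E) : chowH M (M.closure S) = chowH M S := by
  classical
  rw [chowH, chowH]
  exact Finset.sum_congr
    (Finset.filter_congr fun F _ ↦ not_congr (closure_subset_iff F.2.1 hS)) fun _ _ ↦ rfl

open Classical in
lemma chowX_eq_chowH_sub (F : M.ProperFlat) :
    M.chowX F.1 = chowH M M.E - chowH M F.1 - ∑ G : M.ProperFlat with F.1 ⊂ G.1, M.chowX G.1 := by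
  rw [chowH_sub M F.2.1.subset_ground, eq_sub_iff_add_eq,
    ← Finset.sum_insert (f := fun G : M.ProperFlat ↦ M.chowX G.1) (a := F) (by simp)]
  congr 1
  ext G
  have hE : ¬ M.E ⊆ G.1 := fun h ↦ G.2.2 (G.2.1.subset_ground.antisymm h)
  simp only [Finset.mem_insert, Finset.mem_filter, Finset.mem_univ, true_and, hE,
    not_false_eq_true, and_true]
  exact ⟨fun h ↦ h.elim (fun h' ↦ h' ▸ subset_rfl) (·.subset), fun h ↦
    or_iff_not_imp_left.2 fun hne ↦ h.ssubset_of_ne fun h' ↦ hne (Subtype.ext h'.symm)⟩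

lemma chowX_mul_chowH_singleton (he : e ∈ M.E) (heF : e ∉ F) : M.chowX F * chowH M {e} = 0 := by
  rw [chowH_singleton ⟨e, he⟩, mul_comm, M.chowY_mul_chowX ⟨e, he⟩ heF]

/-- Choosing `e ∈ G` outside `F`, one factor `h_G` may be replaced by `h_G - y_e`, a sum of `x_H`
with `e ∈ H`. -/
lemma chowX_mul_chowH_pow_of_natRk_union_le (hG : G ⊆ M.E) (hGF : ¬ G ⊆ F)
    (hn : natRk M (F ∪ G) ≤ natRk M F + n) : M.chowX F * chowH M G ^ n = 0 := by
  classical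
  by_cases hF : M.IsFlat F ∧ F ≠ M.E
  swap
  · rw [M.chowX_of_not hF, zero_mul]
  induction n generalizing F with
  | zero =>
    refine absurd hn (natRk_lt_of_ssubset hF.1 ?_ (union_subset hF.1.subset_ground hG)).not_ge
    exact subset_union_left.ssubset_of_not_subset fun h ↦ hGF (subset_union_right.trans h)
  | succ n ih =>
    obtain ⟨e, heG, heF⟩ := not_subset.1 hGF
    have hpow : M.chowX F * chowH M G ^ (n + 1) =
        M.chowX F * ((chowH M G - chowH M {e}) * chowH M G ^ n) := by
      linear_combination chowH M G ^ n * chowX_mul_chowH_singleton (hG heG) heF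
    rw [hpow, chowH_sub M (singleton_subset_iff.2 heG), Finset.sum_mul, Finset.mul_sum]
    refine Finset.sum_eq_zero fun H hH ↦ ?_
    simp only [Finset.mem_filter, Finset.mem_univ, true_and, singleton_subset_iff] at hH
    by_cases hFH : F ⊆ H.1
    · rw [ih hH.2 (natRk_union_le_of_mem hF.1 hFH hH.1 heG heF hG hn) H.2, mul_zero]
    · rw [← mul_assoc, M.chowX_mul_chowX hFH fun h ↦ heF (h hH.1), zero_mul]

lemma chowX_mul_chowH_pow (hG : G ⊆ M.E) (hGF : ¬ G ⊆ F) (hFG : F ⊆ G)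
    (hn : natRk M G ≤ natRk M F + n) : M.chowX F * chowH M G ^ n = 0 :=
  chowX_mul_chowH_pow_of_natRk_union_le hG hGF (by rwa [union_eq_right.2 hFG])

lemma chowH_mul_chowH (hF : F ⊆ M.E) (hG : G ⊆ M.E) : chowH M F * chowH M G =
    chowH M F * chowH M (M.closure (F ∪ G)) + chowH M G * chowH M (M.closure (F ∪ G)) -
      chowH M (M.closure (F ∪ G)) * chowH M (M.closure (F ∪ G)) := by
  classical
  rw [chowH_closure (union_subset hF hG)]
  have h : (chowH M (F ∪ G) - chowH M F) * (chowH M (F ∪ G) - chowH M G) = 0 := by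
    rw [chowH_sub M subset_union_left, chowH_sub M subset_union_right, Finset.sum_mul_sum]
    refine Finset.sum_eq_zero fun H hH ↦ Finset.sum_eq_zero fun K hK ↦ ?_
    simp only [Finset.mem_filter, Finset.mem_univ, true_and] at hH hK
    exact M.chowX_mul_chowX (fun h ↦ hK.2 (union_subset (hH.1.trans h) hK.1))
      (fun h ↦ hH.2 (union_subset hH.1 (hK.1.trans h)))
  linear_combination h

lemma chowH_mul_chowH_pow (hGF : G ⊆ F) (hF : F ⊆ M.E) (h : natRk M F ≤ natRk M G + n) :
    chowH M G * chowH M F ^ n = chowH M F ^ (n + 1) := by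
  classical
  have h0 : (chowH M F - chowH M G) * chowH M F ^ n = 0 := by
    rw [chowH_sub M hGF, Finset.sum_mul]
    refine Finset.sum_eq_zero fun H hH ↦ ?_
    simp only [Finset.mem_filter, Finset.mem_univ, true_and] at hH
    refine chowX_mul_chowH_pow_of_natRk_union_le hF hH.2 ?_
    have hsubmod := natRk_inter_add_union_le M H.1 F
    have hmono := natRk_mono M (subset_inter hH.1 hGF)
    omega
  linear_combination -h0

lemma chowH_pow_eq_zero (hF : F ⊆ M.E) (h : natRk M F < n) : chowH M F ^ n = 0 := by
  obtain ⟨n, rfl⟩ := Nat.exists_eq_add_one.2 (Nat.zero_lt_of_lt h)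
  rw [← chowH_mul_chowH_pow (empty_subset F) hF (by rw [natRk_empty]; omega), chowH_empty,
    zero_mul]

lemma chowH_pow_mul_chowH_pow (hGF : G ⊆ F) (hF : F ⊆ M.E) (m : ℕ)
    (h : natRk M F ≤ natRk M G + n) :
    chowH M G ^ m * chowH M F ^ n = chowH M F ^ (n + m) := by
  induction m with
  | zero => simp
  | succ m ih =>
    rw [pow_succ', mul_assoc, ih, chowH_mul_chowH_pow hGF hF (by omega), add_assoc]

open Classical in
/-- The class `x_F`, with the convention `x_E = 1` for the ground set. -/
def chowXTop (M : Matroid α) [M.Finite] (F : Set α) : M.AugChow :=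
  if F = M.E then 1 else M.chowX F

lemma chowXTop_mul_chowX (hFG : ¬ F ⊆ G) (hGF : ¬ G ⊆ F) :
    chowXTop M G * M.chowX F = 0 := by
  by_cases hF : M.IsFlat F ∧ F ≠ M.E
  · rw [chowXTop, if_neg fun h : G = M.E ↦ hFG (h ▸ hF.1.subset_ground), M.chowX_mul_chowX hGF hFG]
  · rw [M.chowX_of_not hF, mul_zero]

/-- Only the term `x_F` of `h_G - h_F` survives. -/
lemma chowXTop_mul_pow_mul_chowH_sub (hF : M.IsFlat F) (hG : M.IsFlat G) (hFG : F ⊂ G)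
    (hn : natRk M G ≤ n + 1 + natRk M F) :
    chowXTop M G * chowH M G ^ n * (chowH M G - chowH M F) =
      chowXTop M G * chowH M G ^ n * M.chowX F := by
  classical
  obtain ⟨P, rfl⟩ : ∃ P : M.ProperFlat, P.1 = F :=
    ⟨⟨F, hF, fun h ↦ hFG.not_subset (h ▸ hG.subset_ground)⟩, rfl⟩
  rw [chowH_sub M hFG.subset, Finset.mul_sum,
    Finset.sum_eq_single P _ fun h ↦ by simp [hFG.not_subset] at h]
  intro H hH hne
  simp only [Finset.mem_filter, Finset.mem_univ, true_and] at hH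
  by_cases hHG : H.1 ⊆ G
  · have hlt : natRk M P.1 < natRk M H.1 := natRk_lt_of_ssubset hF
      (hH.1.ssubset_of_ne fun h ↦ hne (Subtype.ext h.symm)) H.2.1.subset_ground
    have hzero := chowX_mul_chowH_pow (n := n) hG.subset_ground hH.2 hHG (by omega)
    linear_combination chowXTop M G * hzero
  · linear_combination chowH M G ^ n * chowXTop_mul_chowX (M := M) hHG hH.2

lemma chowXTop_mul_pow_mul_chowX (hF : M.IsFlat F) (hG : M.IsFlat G) (hFG : F ⊂ G)
    (hn : n + 1 + natRk M F = natRk M G) :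
    chowXTop M G * chowH M G ^ n * (M.chowX F * chowH M F ^ natRk M F) =
      chowXTop M G * chowH M G ^ natRk M G := by
  have hpow := chowH_pow_mul_chowH_pow hFG.subset hG.subset_ground (n := n + 1) (natRk M F)
    (by omega)
  have hzero := chowH_pow_eq_zero hF.subset_ground (n := natRk M F + 1) (by omega)
  rw [← hn, ← hpow]
  linear_combination -chowH M F ^ natRk M F * chowXTop_mul_pow_mul_chowH_sub hF hG hFG hn.ge -
    chowXTop M G * chowH M G ^ n * hzero

lemma chowH_ground_pow_mul_chowX (hF : M.IsFlat F) (hFE : F ≠ M.E) :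
    chowH M M.E ^ (M.natRank - natRk M F - 1) * (M.chowX F * chowH M F ^ natRk M F) =
      chowH M M.E ^ M.natRank := by
  have hssub := hF.subset_ground.ssubset_of_ne hFE
  have hlt := natRk_lt_of_ssubset hF hssub subset_rfl
  rw [natRk_ground] at hlt
  simpa [chowXTop, natRk_ground] using chowXTop_mul_pow_mul_chowX hF M.ground_isFlat hssub
    (n := M.natRank - natRk M F - 1) (by rw [natRk_ground]; omega)

end ChowH

section Span

variable (M : Matroid α)

/-- The sum of the ranks of the members of a multiset. -/
def rankSum (s : Multiset (Set α)) : ℕ := (s.map (natRk M)).sum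

@[simp] lemma rankSum_cons (S : Set α) (s : Multiset (Set α)) :
    rankSum M (S ::ₘ s) = natRk M S + rankSum M s := by simp [rankSum]

@[simp] lemma rankSum_add (s t : Multiset (Set α)) :
    rankSum M (s + t) = rankSum M s + rankSum M t := by simp [rankSum]

variable [M.Finite]

lemma rankSum_le (s : Multiset (Set α)) : rankSum M s ≤ s.card * M.natRank := by
  simpa [rankSum] using Multiset.sum_le_card_nsmul (s.map (natRk M)) M.natRank
    (by simpa using fun S _ ↦ natRk_le_natRank M S)

@[simp] lemma chowHProd_zero : chowHProd M 0 = 1 := by simp [chowHProd]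

@[simp] lemma chowHProd_cons (S : Set α) (s : Multiset (Set α)) :
    chowHProd M (S ::ₘ s) = chowH M S * chowHProd M s := by simp [chowHProd]

@[simp] lemma chowHProd_add (s t : Multiset (Set α)) :
    chowHProd M (s + t) = chowHProd M s * chowHProd M t := by simp [chowHProd]

@[simp] lemma chowHProd_replicate (n : ℕ) (S : Set α) :
    chowHProd M (Multiset.replicate n S) = chowH M S ^ n := by simp [chowHProd]

lemma chowX_mem_span_chowH (F : M.ProperFlat) :
    M.chowX F.1 ∈ Submodule.span ℚ (chowH M '' {S | M.IsFlat S ∧ F.1 ⊆ S}) := by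
  classical
  induction F using properFlat_induction with
  | h F ih =>
  rw [chowX_eq_chowH_sub]
  refine sub_mem (sub_mem ?_ ?_) (Submodule.sum_mem _ fun G hG ↦ ?_)
  · exact Submodule.subset_span ⟨_, ⟨M.ground_isFlat, F.2.1.subset_ground⟩, rfl⟩
  · exact Submodule.subset_span ⟨_, ⟨F.2.1, subset_rfl⟩, rfl⟩
  · have hFG : F.1 ⊂ G.1 := (Finset.mem_filter.1 hG).2
    exact Submodule.span_mono (image_mono fun S ↦ And.imp_right hFG.subset.trans) (ih G hFG)

open scoped Pointwise in
lemma span_chowH_pow_le (P : Set α → Prop) (n : ℕ) :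
    Submodule.span ℚ (chowH M '' {S | P S}) ^ n ≤
      Submodule.span ℚ (chowHProd M '' {s | s.card = n ∧ ∀ S ∈ s, P S}) := by
  rw [Submodule.span_pow]
  refine Submodule.span_mono ?_
  induction n with
  | zero =>
    rintro _ rfl
    exact ⟨0, by simp, by simp⟩
  | succ n ih =>
    rw [pow_succ]
    rintro _ ⟨a, ha, _, ⟨S, hS, rfl⟩, rfl⟩
    obtain ⟨s, hs, rfl⟩ := ih ha
    refine ⟨S ::ₘ s, ⟨by simp [hs.1], ?_⟩, by simp [mul_comm]⟩
    simpa using ⟨hS, hs.2⟩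

lemma chowGr_le_span_chowHProd (k : ℕ) : M.chowGr k ≤
    Submodule.span ℚ (chowHProd M '' {s | s.card = k ∧ ∀ S ∈ s, M.IsFlat S}) := by
  refine le_trans ?_ (span_chowH_pow_le M M.IsFlat k)
  rw [chowGr, ← homogeneousSubmodule_one_pow, Submodule.map_pow]
  refine pow_le_pow_left' ?_ k
  rw [homogeneousSubmodule_one_eq_span_X, Submodule.map_span, Submodule.span_le]
  rintro _ ⟨_, ⟨e | F, rfl⟩, rfl⟩
  · change M.chowY e ∈ _
    rw [← chowH_singleton, ← chowH_closure (singleton_subset_iff.2 e.2)]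
    exact Submodule.subset_span ⟨_, M.isFlat_closure _, rfl⟩
  · change M.chowMk (X (Sum.inr F)) ∈ _
    rw [← chowX_eq]
    exact Submodule.span_mono (image_mono fun S hS ↦ hS.1) (chowX_mem_span_chowH M F)

lemma iSup_chowGr : ⨆ k, M.chowGr k = ⊤ := by
  refine eq_top_iff.2 fun z _ ↦ ?_
  obtain ⟨p, rfl⟩ := Ideal.Quotient.mk_surjective z
  change M.chowMk p ∈ _
  rw [← sum_homogeneousComponent p, map_sum]
  exact Submodule.sum_mem _ fun k _ ↦ Submodule.mem_iSup_of_mem k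
    ⟨_, homogeneousComponent_isHomogeneous k p, rfl⟩

lemma span_chowHProd_isFlat :
    Submodule.span ℚ (chowHProd M '' {s | ∀ S ∈ s, M.IsFlat S}) = ⊤ := by
  rw [eq_top_iff, ← iSup_chowGr]
  exact iSup_le fun k ↦
    (chowGr_le_span_chowHProd M k).trans (Submodule.span_mono (image_mono fun s hs ↦ hs.2))

end Span

section Straightening

/-- Standard multisets of flats: the members form a chain, and their multiplicities are bounded by
the differences of consecutive ranks. They index the monomial basis of `CH(M)`. -/
structure Standard (M : Matroid α) (s : Multiset (Set α)) : Prop where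
  isFlat : ∀ F ∈ s, M.IsFlat F
  chain : ∀ F ∈ s, ∀ G ∈ s, F ⊆ G ∨ G ⊆ F
  count_le : open Classical in ∀ F ∈ s, s.count F ≤ natRk M F
  count_lt : open Classical in ∀ F ∈ s, ∀ G ∈ s, G ⊂ F → s.count F + natRk M G < natRk M F

/-- The multisets of flats of the same size as `s` and with a larger sum of ranks; a nonstandard
product of classes `h_F` is rewritten in terms of these. -/
def higherMultisets (M : Matroid α) (s : Multiset (Set α)) : Set (Multiset (Set α)) :=
  {t | (∀ F ∈ t, M.IsFlat F) ∧ t.card = s.card ∧ rankSum M s < rankSum M t}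

variable {M : Matroid α} [M.Finite] {F G : Set α} {s t : Multiset (Set α)} {n : ℕ}

lemma chowHProd_cons_cons_mem_span_of_not_subset (hs : ∀ K ∈ F ::ₘ G ::ₘ t, M.IsFlat K)
    (hFG : ¬ F ⊆ G) (hGF : ¬ G ⊆ F) : chowHProd M (F ::ₘ G ::ₘ t) ∈
      Submodule.span ℚ (chowHProd M '' higherMultisets M (F ::ₘ G ::ₘ t)) := by
  simp only [Multiset.mem_cons, forall_eq_or_imp] at hs
  obtain ⟨hF, hG, ht⟩ := hs
  have hFH := M.subset_closure_of_subset (subset_union_left (s := F) (t := G))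
    (union_subset hF.subset_ground hG.subset_ground)
  have hGH := M.subset_closure_of_subset (subset_union_right (s := F) (t := G))
    (union_subset hF.subset_ground hG.subset_ground)
  have hmul := chowH_mul_chowH hF.subset_ground hG.subset_ground
  set H := M.closure (F ∪ G)
  have hH : M.IsFlat H := M.isFlat_closure _
  have hF_lt : natRk M F < natRk M H := natRk_lt_of_ssubset hF
    (hFH.ssubset_of_not_subset fun h ↦ hGF (hGH.trans h)) hH.subset_ground
  have hG_lt : natRk M G < natRk M H := natRk_lt_of_ssubset hG
    (hGH.ssubset_of_not_subset fun h ↦ hFG (hFH.trans h)) hH.subset_ground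
  have hexpand : chowHProd M (F ::ₘ G ::ₘ t) = chowHProd M (F ::ₘ H ::ₘ t) +
      chowHProd M (G ::ₘ H ::ₘ t) - chowHProd M (H ::ₘ H ::ₘ t) := by
    simp only [chowHProd_cons]
    linear_combination chowHProd M t * hmul
  rw [hexpand]
  refine sub_mem (add_mem ?_ ?_) ?_ <;> refine Submodule.subset_span (mem_image_of_mem _ ?_) <;>
    refine ⟨by simp only [Multiset.mem_cons, forall_eq_or_imp]; tauto, by simp, ?_⟩ <;>
    simp only [rankSum_cons] <;> omega

lemma chowHProd_replicate_add_cons_mem_span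
    (hs : ∀ K ∈ Multiset.replicate n F + G ::ₘ t, M.IsFlat K) (hF : M.IsFlat F) (hGF : G ⊂ F)
    (hn : natRk M F ≤ n + natRk M G) : chowHProd M (Multiset.replicate n F + G ::ₘ t) ∈
      Submodule.span ℚ (chowHProd M '' higherMultisets M (Multiset.replicate n F + G ::ₘ t)) := by
  simp only [Multiset.mem_add, Multiset.mem_cons, or_imp, forall_and, forall_eq] at hs
  refine Submodule.subset_span ⟨Multiset.replicate (n + 1) F + t, ⟨?_, ?_, ?_⟩, ?_⟩
  · simp only [Multiset.mem_add, or_imp, forall_and]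
    exact ⟨fun K hK ↦ Multiset.eq_of_mem_replicate hK ▸ hF, hs.2.2⟩
  · simp only [Multiset.card_add, Multiset.card_replicate, Multiset.card_cons]
    omega
  · have hlt := natRk_lt_of_ssubset hs.2.1 hGF hF.subset_ground
    simp only [rankSum_add, Multiset.replicate_succ, rankSum_cons]
    omega
  · rw [chowHProd_add, chowHProd_add, chowHProd_replicate, chowHProd_replicate, chowHProd_cons,
      ← chowH_mul_chowH_pow hGF.subset hF.subset_ground (by omega)]
    ring

lemma chowHProd_mem_span_higherMultisets (hs : ∀ F ∈ s, M.IsFlat F) (hst : ¬ Standard M s) :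
    chowHProd M s ∈ Submodule.span ℚ (chowHProd M '' higherMultisets M s) := by
  classical
  by_cases hchain : ∀ F ∈ s, ∀ G ∈ s, F ⊆ G ∨ G ⊆ F
  swap
  · push Not at hchain
    obtain ⟨F, hF, G, hG, hFG, hGF⟩ := hchain
    obtain ⟨t, rfl⟩ := Multiset.exists_cons_of_mem hF
    obtain ⟨t, rfl⟩ := Multiset.exists_cons_of_mem
      ((Multiset.mem_cons.1 hG).resolve_left fun h ↦ hFG h.symm.subset)
    exact chowHProd_cons_cons_mem_span_of_not_subset hs hFG hGF
  have hsplit (F : Set α) : ∃ t, s = Multiset.replicate (s.count F) F + t :=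
    Multiset.le_iff_exists_add.1 (Multiset.le_count_iff_replicate_le.1 le_rfl)
  by_cases hle : ∀ F ∈ s, s.count F ≤ natRk M F
  swap
  · push Not at hle
    obtain ⟨F, hF, hlt⟩ := hle
    obtain ⟨t, ht⟩ := hsplit F
    rw [ht, chowHProd_add, chowHProd_replicate,
      chowH_pow_eq_zero (hs F hF).subset_ground hlt, zero_mul]
    exact zero_mem _
  have hlt : ¬ ∀ F ∈ s, ∀ G ∈ s, G ⊂ F → s.count F + natRk M G < natRk M F :=
    fun hlt ↦ hst ⟨hs, hchain, hle, hlt⟩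
  push Not at hlt
  obtain ⟨F, hF, G, hG, hGF, hn⟩ := hlt
  obtain ⟨t, ht⟩ := hsplit F
  have hGt : G ∈ t := (Multiset.mem_add.1 (ht ▸ hG)).resolve_left
    fun h ↦ hGF.ne (Multiset.eq_of_mem_replicate h)
  obtain ⟨t, rfl⟩ := Multiset.exists_cons_of_mem hGt
  rw [ht]
  exact chowHProd_replicate_add_cons_mem_span (ht ▸ hs) (hs F hF) hGF hn

lemma chowHProd_mem_span_standard (hs : ∀ F ∈ s, M.IsFlat F) :
    chowHProd M s ∈ Submodule.span ℚ (chowHProd M '' {t | Standard M t}) := by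
  induction hn : s.card * M.natRank - rankSum M s using Nat.strong_induction_on generalizing s with
  | _ n ih =>
  by_cases hst : Standard M s
  · exact Submodule.subset_span ⟨s, hst, rfl⟩
  · refine Submodule.span_le.2 ?_ (chowHProd_mem_span_higherMultisets hs hst)
    rintro _ ⟨t, ⟨ht, hcard, hrank⟩, rfl⟩
    refine ih _ ?_ ht rfl
    have hle := rankSum_le M t
    rw [hcard] at hle ⊢
    omega

lemma span_chowHProd_standard (M : Matroid α) [M.Finite] :
    Submodule.span ℚ (chowHProd M '' {s | Standard M s}) = ⊤ := by
  rw [eq_top_iff, ← span_chowHProd_isFlat, Submodule.span_le]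
  rintro _ ⟨s, hs, rfl⟩
  exact chowHProd_mem_span_standard hs

end Straightening

section Dominance

variable {M : Matroid α} {s t : Multiset (Set α)}

lemma exists_mem_forall_subset_mem (hs : s ≠ 0) (hchain : ∀ F ∈ s, ∀ G ∈ s, F ⊆ G ∨ G ⊆ F) :
    ∃ F ∈ s, ∀ G ∈ s, F ⊆ G := by
  classical
  obtain ⟨F, hF⟩ := s.toFinset.exists_minimal (Multiset.toFinset_nonempty.2 hs)
  simp only [Multiset.mem_toFinset] at hF
  exact ⟨F, hF.prop, fun G hG ↦ (hchain F hF.prop G hG).elim id (hF.le_of_le hG)⟩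

lemma subsetCount_pos {K : Set α} : 0 < subsetCount s K ↔ ∃ S ∈ s, S ⊆ K := by
  classical
  exact Multiset.countP_pos

lemma rel_subset_of_subsetCount_le (hchain : ∀ F ∈ s, ∀ G ∈ s, F ⊆ G ∨ G ⊆ F)
    (hcard : t.card = s.card) (h : ∀ F ∈ s, subsetCount s F ≤ subsetCount t F) :
    Multiset.Rel (· ⊆ ·) t s := by
  induction hn : s.card generalizing s t with
  | zero =>
    rw [Multiset.card_eq_zero.1 hn, Multiset.card_eq_zero.1 (hcard.trans hn)]
    exact Multiset.Rel.zero
  | succ n ih =>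
    obtain ⟨F, hF, hmin⟩ := exists_mem_forall_subset_mem (Multiset.card_pos.1 (by omega)) hchain
    obtain ⟨G, hG, hGF⟩ : ∃ G ∈ t, G ⊆ F :=
      subsetCount_pos.1 ((subsetCount_pos.2 ⟨F, hF, subset_rfl⟩).trans_le (h F hF))
    obtain ⟨s, rfl⟩ := Multiset.exists_cons_of_mem hF
    obtain ⟨t, rfl⟩ := Multiset.exists_cons_of_mem hG
    simp only [Multiset.card_cons, Nat.add_right_cancel_iff] at hcard hn
    refine Multiset.Rel.cons hGF (ih (fun K hK L hL ↦ ?_) hcard (fun K hK ↦ ?_) hn)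
    · exact hchain K (Multiset.mem_cons_of_mem hK) L (Multiset.mem_cons_of_mem hL)
    · have hFK := hmin K (Multiset.mem_cons_of_mem hK)
      have hle := h K (Multiset.mem_cons_of_mem hK)
      rw [subsetCount_cons, subsetCount_cons, subsetCount_singleton_eq_one.2 hFK,
        subsetCount_singleton_eq_one.2 (hGF.trans hFK)] at hle
      omega

lemma rankSum_le_of_rel [M.RankFinite] (h : Multiset.Rel (· ⊆ ·) t s) :
    rankSum M t ≤ rankSum M s := by
  induction h with
  | zero => rfl
  | cons hGF _ ih =>
    rw [rankSum_cons, rankSum_cons]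
    exact add_le_add (natRk_mono M hGF) ih

lemma eq_of_rel_of_rankSum_le [M.RankFinite] (h : Multiset.Rel (· ⊆ ·) t s)
    (ht : ∀ F ∈ t, M.IsFlat F) (hs : ∀ F ∈ s, F ⊆ M.E) (hle : rankSum M s ≤ rankSum M t) :
    t = s := by
  induction h with
  | zero => rfl
  | @cons G F t s hGF hrel ih =>
    simp only [Multiset.mem_cons, forall_eq_or_imp, rankSum_cons] at ht hs hle
    have hrank := natRk_mono M hGF
    have hsum := rankSum_le_of_rel (M := M) hrel
    rw [eq_of_subset_of_natRk_le ht.1 hGF hs.1 (by omega), ih ht.2 hs.2 (by omega)]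

end Dominance

section DegreeChowX

variable {M : Matroid α} {s t : Multiset (Set α)}

lemma subsetCount_add (s t : Multiset (Set α)) (K : Set α) :
    subsetCount (s + t) K = subsetCount s K + subsetCount t K := by
  classical
  exact Multiset.countP_add ..

lemma subsetCount_le_card (s : Multiset (Set α)) (K : Set α) : subsetCount s K ≤ s.card := by
  classical
  exact Multiset.countP_le_card ..

lemma hallRado_cons {S : Set α} : HallRado M (S ::ₘ s) ↔ s.card + 1 = M.natRank ∧
    ∀ K, M.IsFlat K → subsetCount s K + subsetCount {S} K ≤ natRk M K :=
  ⟨fun ⟨hc, h⟩ ↦ by simpa only [Multiset.card_cons, subsetCount_cons] using And.intro hc h,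
    fun ⟨hc, h⟩ ↦ ⟨by simpa only [Multiset.card_cons] using hc,
      by simpa only [subsetCount_cons] using h⟩⟩

lemma hallRado_cons_iff_not_subset {S T : Set α} (hcard : s.card + 1 = M.natRank)
    (hs : ∀ G, M.IsFlat G → subsetCount s G ≤ natRk M G) (hT : M.IsFlat T)
    (htight : natRk M T ≤ subsetCount s T)
    (hmax : ∀ G, M.IsFlat G → natRk M G ≤ subsetCount s G → G ⊆ T) :
    HallRado M (S ::ₘ s) ↔ ¬ S ⊆ T := by
  rw [hallRado_cons, and_iff_right hcard]
  refine ⟨fun h hST ↦ ?_, fun hST K hK ↦ ?_⟩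
  · have := h T hT
    rw [subsetCount_singleton_eq_one.2 hST] at this
    omega
  · by_contra hlt
    have hSK := subsetCount_singleton_le_one S K
    have hK_le := hs K hK
    exact hST ((subsetCount_singleton_eq_one.1 (by omega)).trans (hmax K hK (by omega)))

variable [M.Finite]

lemma exists_greatest_tight (hcard : s.card + 1 = M.natRank)
    (hs : ∀ G, M.IsFlat G → subsetCount s G ≤ natRk M G) :
    ∃ T : M.ProperFlat, natRk M T.1 ≤ subsetCount s T.1 ∧
      ∀ G, M.IsFlat G → natRk M G ≤ subsetCount s G → G ⊆ T.1 := by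
  have hfin : {G | M.IsFlat G ∧ natRk M G ≤ subsetCount s G}.Finite :=
    M.ground_finite.finite_subsets.subset fun G hG ↦ hG.1.subset_ground
  obtain ⟨T, hT⟩ := hfin.exists_maximal
    ⟨M.closure ∅, M.isFlat_closure _, by rw [natRk_closure, natRk_empty]; exact Nat.zero_le _⟩
  have hTE : T ≠ M.E := by
    rintro rfl
    have htight := hT.prop.2
    have hle := subsetCount_le_card s M.E
    rw [natRk_ground] at htight
    omega
  refine ⟨⟨T, hT.prop.1, hTE⟩, hT.prop.2, fun G hG hG' ↦ ?_⟩
  have hsub := M.subset_closure (T ∪ G) (union_subset hT.prop.1.subset_ground hG.subset_ground)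
  exact (subset_union_right.trans hsub).trans (hT.le_of_ge ⟨M.isFlat_closure _,
    natRk_closure_union_le_subsetCount hs hT.prop.1 hG hT.prop.2 hG'⟩
    (subset_union_left.trans hsub))

variable [M.Loopless]

open Classical in
/-- As `x_F` is `h_E - h_F` minus the sum of the `x_G` with `F ⊂ G`, this follows by induction from
the degrees of the products of `s` with one more class `h_S`. -/
lemma chowDeg_chowX_mul_chowHProd (hf : ∀ S ∈ s, M.IsFlat S) (hcard : s.card + 1 = M.natRank)
    (hs : ∀ G, M.IsFlat G → subsetCount s G ≤ natRk M G) {T : M.ProperFlat}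
    (htight : natRk M T.1 ≤ subsetCount s T.1)
    (hmax : ∀ G, M.IsFlat G → natRk M G ≤ subsetCount s G → G ⊆ T.1) (F : M.ProperFlat) :
    chowDeg M (M.chowX F.1 * chowHProd M s) = if F = T then 1 else 0 := by
  have hdeg (S : Set α) (hS : M.IsFlat S) :
      chowDeg M (chowH M S * chowHProd M s) = if S ⊆ T.1 then 0 else 1 := by
    rw [← chowHProd_cons, chowDeg_chowHProd (by simpa using ⟨hS, hf⟩)]
    simp [hallRado_cons_iff_not_subset hcard hs T.2.1 htight hmax]
  induction F using properFlat_induction with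
  | h F ih =>
  have hE : ¬ M.E ⊆ T.1 := fun h ↦ T.2.2 (T.2.1.subset_ground.antisymm h)
  have hsum : ∑ G : M.ProperFlat with F.1 ⊂ G.1, chowDeg M (M.chowX G.1 * chowHProd M s) =
      if F.1 ⊂ T.1 then 1 else 0 := by
    rw [Finset.sum_congr rfl fun G hG ↦ ih G (Finset.mem_filter.1 hG).2, Finset.sum_ite_eq']
    simp
  rw [chowX_eq_chowH_sub, sub_mul, sub_mul, map_sub, map_sub, hdeg _ F.2.1,
    hdeg _ M.ground_isFlat, Finset.sum_mul, map_sum, hsum, if_neg hE]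
  rcases eq_or_ne F T with rfl | hne
  · simp
  · have hiff : F.1 ⊂ T.1 ↔ F.1 ⊆ T.1 :=
      ⟨fun h ↦ h.subset, fun h ↦ h.ssubset_of_ne fun h' ↦ hne (Subtype.ext h')⟩
    simp only [hiff, if_neg hne]
    split_ifs <;> norm_num

lemma chowDeg_mul_eq_zero_of_mem_span {A : Set M.AugChow} {p z : M.AugChow}
    (hA : ∀ a ∈ A, chowDeg M (a * p) = 0) (hz : z ∈ Submodule.span ℚ A) :
    chowDeg M (z * p) = 0 :=
  (Submodule.span_le (p := LinearMap.ker (chowDeg M ∘ₗ LinearMap.mulRight ℚ p))).2 hA hz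

lemma chowDeg_mul_chowHProd_eq_zero (hf : ∀ S ∈ s, M.IsFlat S)
    (h : ∀ S, M.IsFlat S → ¬ HallRado M (S ::ₘ s)) {z : M.AugChow}
    (hz : z ∈ Submodule.span ℚ (chowH M '' {S | M.IsFlat S})) :
    chowDeg M (z * chowHProd M s) = 0 := by
  refine chowDeg_mul_eq_zero_of_mem_span ?_ hz
  rintro _ ⟨S, hS, rfl⟩
  rw [← chowHProd_cons, chowDeg_chowHProd (by simpa using ⟨hS, hf⟩), if_neg (h S hS)]

lemma chowX_mem_span_chowH_isFlat (M : Matroid α) [M.Finite] (F : Set α) :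
    M.chowX F ∈ Submodule.span ℚ (chowH M '' {S | M.IsFlat S}) := by
  by_cases hF : M.IsFlat F ∧ F ≠ M.E
  · exact Submodule.span_mono (image_mono fun _ hS ↦ hS.1) (chowX_mem_span_chowH M ⟨F, hF⟩)
  · rw [M.chowX_of_not hF]
    exact zero_mem _

lemma subsetCount_of_chowDeg_chowX_mul_ne_zero {F : Set α} (hf : ∀ S ∈ s, M.IsFlat S)
    (h : chowDeg M (M.chowX F * chowHProd M s) ≠ 0) :
    s.card + 1 = M.natRank ∧ (∀ G, M.IsFlat G → subsetCount s G ≤ natRk M G) ∧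
      subsetCount s F = natRk M F := by
  by_cases hF : M.IsFlat F ∧ F ≠ M.E
  swap
  · rw [M.chowX_of_not hF, zero_mul, map_zero] at h
    exact absurd rfl h
  obtain ⟨S, hS⟩ : ∃ S, HallRado M (S ::ₘ s) := by
    by_contra! hno
    exact h (chowDeg_mul_chowHProd_eq_zero hf (fun S _ ↦ hno S) (chowX_mem_span_chowH_isFlat M F))
  obtain ⟨hcard, hle⟩ := hallRado_cons.1 hS
  replace hle : ∀ G, M.IsFlat G → subsetCount s G ≤ natRk M G :=
    fun G hG ↦ (Nat.le_add_right _ _).trans (hle G hG)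
  obtain ⟨T, htight, hmax⟩ := exists_greatest_tight hcard hle
  obtain rfl : ⟨F, hF⟩ = T := by
    by_contra hne
    classical
    exact h ((chowDeg_chowX_mul_chowHProd hf hcard hle htight hmax ⟨F, hF⟩).trans (if_neg hne))
  exact ⟨hcard, hle, (hle F hF.1).antisymm htight⟩

/-- The span of the classes `h_S` of the flats not contained in `F`. -/
def spanNotLE (M : Matroid α) [M.Finite] (F : Set α) : Submodule ℚ M.AugChow :=
  Submodule.span ℚ (chowH M '' {S | M.IsFlat S ∧ ¬ S ⊆ F})

lemma chowDeg_chowX_mul_eq_zero_of_mem_spanNotLE_pow {F : Set α} {n : ℕ}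
    (hn : M.natRank ≤ natRk M F + n) {u : M.AugChow} (hu : u ∈ spanNotLE M F ^ n)
    (p : M.AugChow) : chowDeg M (M.chowX F * u * p) = 0 := by
  rw [mul_comm (M.chowX F), mul_assoc]
  refine chowDeg_mul_eq_zero_of_mem_span ?_ (span_chowH_pow_le M _ n hu)
  rintro _ ⟨s, ⟨hcard, hs⟩, rfl⟩
  have hp : p ∈ Submodule.span ℚ (chowHProd M '' {t | ∀ S ∈ t, M.IsFlat S}) := by
    rw [span_chowHProd_isFlat]
    trivial
  rw [show chowHProd M s * (M.chowX F * p) = p * (M.chowX F * chowHProd M s) by ring]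
  refine chowDeg_mul_eq_zero_of_mem_span ?_ hp
  rintro _ ⟨t, ht, rfl⟩
  rw [mul_left_comm, ← chowHProd_add]
  by_contra hne
  obtain ⟨hcard', -, hcount⟩ := subsetCount_of_chowDeg_chowX_mul_ne_zero (fun S hS ↦
    (Multiset.mem_add.1 hS).elim (ht S) (fun h ↦ (hs S h).1)) hne
  have hzero : subsetCount s F = 0 := Nat.eq_zero_of_not_pos fun h ↦ by
    obtain ⟨S, hS, hSF⟩ := subsetCount_pos.1 h
    exact (hs S hS).2 hSF
  have hle := subsetCount_le_card t F
  rw [subsetCount_add, hzero] at hcount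
  rw [Multiset.card_add] at hcard'
  omega

end DegreeChowX

section Grading

variable (M : Matroid α) [M.Finite]

lemma chowGr_one_pow (k : ℕ) : M.chowGr 1 ^ k = M.chowGr k := by
  rw [chowGr, ← Submodule.map_pow, homogeneousSubmodule_one_pow, chowGr]

lemma chowX_mem_chowGr (F : Set α) : M.chowX F ∈ M.chowGr 1 := by
  by_cases hF : M.IsFlat F ∧ F ≠ M.E
  · rw [M.chowX_eq ⟨F, hF⟩]
    exact ⟨_, isHomogeneous_X ℚ _, rfl⟩
  · rw [M.chowX_of_not hF]
    exact zero_mem _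

lemma chowH_mem_chowGr (S : Set α) : chowH M S ∈ M.chowGr 1 :=
  Submodule.sum_mem _ fun F _ ↦ chowX_mem_chowGr M F.1

lemma chowH_pow_mem_chowGr (S : Set α) (n : ℕ) : chowH M S ^ n ∈ M.chowGr n := by
  rw [← chowGr_one_pow]
  exact Submodule.pow_mem_pow _ (chowH_mem_chowGr M S) n

lemma chowHProd_mem_pow {P : Submodule ℚ M.AugChow} {s : Multiset (Set α)}
    (h : ∀ S ∈ s, chowH M S ∈ P) : chowHProd M s ∈ P ^ s.card := by
  induction s using Multiset.induction with
  | empty => rw [chowHProd_zero, Multiset.card_zero, pow_zero]; exact Submodule.one_le.1 le_rfl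
  | cons S s ih =>
    rw [Multiset.forall_mem_cons] at h
    rw [chowHProd_cons, Multiset.card_cons, pow_succ']
    exact Submodule.mul_mem_mul h.1 (ih h.2)

lemma chowHProd_mem_chowGr (s : Multiset (Set α)) : chowHProd M s ∈ M.chowGr s.card := by
  rw [← chowGr_one_pow]
  exact chowHProd_mem_pow M fun S _ ↦ chowH_mem_chowGr M S

variable {M}

@[elab_as_elim]
lemma chowGr_induction {motive : M.AugChow → Prop} (mem : ∀ k, ∀ a ∈ M.chowGr k, motive a)
    (add : ∀ a b, motive a → motive b → motive (a + b)) (z : M.AugChow) : motive z :=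
  Submodule.iSup_induction M.chowGr (motive := motive) (iSup_chowGr M ▸ Submodule.mem_top) mem
    (mem 0 0 (zero_mem _)) add

lemma chowDeg_eq_zero_of_mem_chowGr [M.Loopless] {k : ℕ} (hk : k ≠ M.natRank) {z : M.AugChow}
    (hz : z ∈ M.chowGr k) : chowDeg M z = 0 := by
  suffices h : chowDeg M (z * 1) = 0 by rwa [mul_one] at h
  refine chowDeg_mul_eq_zero_of_mem_span ?_ (chowGr_le_span_chowHProd M k hz)
  rintro _ ⟨s, ⟨hs, hf⟩, rfl⟩
  rw [mul_one, chowDeg_chowHProd hf, if_neg fun h ↦ hk (hs.symm.trans h.card_eq)]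

end Grading

lemma Standard.of_le {M : Matroid α} {s t : Multiset (Set α)} (h : Standard M s) (hle : t ≤ s) :
    Standard M t where
  isFlat F hF := h.isFlat F (Multiset.mem_of_le hle hF)
  chain F hF G hG := h.chain F (Multiset.mem_of_le hle hF) G (Multiset.mem_of_le hle hG)
  count_le F hF :=
    (Multiset.count_le_of_le F hle).trans (h.count_le F (Multiset.mem_of_le hle hF))
  count_lt F hF G hG hGF := (Nat.add_le_add_right (Multiset.count_le_of_le F hle) _).trans_lt
    (h.count_lt F (Multiset.mem_of_le hle hF) G (Multiset.mem_of_le hle hG) hGF)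

section TestClasses

variable {M : Matroid α} [M.Finite] {F G : Set α} {s t : Multiset (Set α)} {u v : M.AugChow}

/-- `u` is a test class for the product of the `h_F`, `F ∈ s`, in the interval of flats below `G`:
it completes this product to `h_G ^ rk G`, and for every member `F ≠ G` of `s` it has a factor `x_F`
together with so many factors in `spanNotLE M F` that it annihilates the products with fewer members
below `F` than `s`. -/
structure IsTestClass (M : Matroid α) [M.Finite] (G : Set α) (s : Multiset (Set α))
    (u : M.AugChow) : Prop where
  mul_eq : chowXTop M G * (chowHProd M s * u) = chowXTop M G * chowH M G ^ natRk M G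
  exists_mem_chowGr : ∃ n, u ∈ M.chowGr n ∧ n + s.card = natRk M G
  exists_eq_mul : ∀ F ∈ s, F ≠ G → ∃ (m : ℕ) (v p : M.AugChow), u = M.chowX F * v * p ∧
    v ∈ spanNotLE M F ^ m ∧ m + s.card + 1 + natRk M F = natRk M G + subsetCount s F

lemma isTestClass_replicate {a : ℕ} (ha : a ≤ natRk M G) :
    IsTestClass M G (Multiset.replicate a G) (chowH M G ^ (natRk M G - a)) where
  mul_eq := by rw [chowHProd_replicate, ← pow_add, Nat.add_sub_cancel' ha]
  exists_mem_chowGr :=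
    ⟨_, chowH_pow_mem_chowGr M G _, by rw [Multiset.card_replicate, Nat.sub_add_cancel ha]⟩
  exists_eq_mul _ hF hFG := absurd (Multiset.eq_of_mem_replicate hF) hFG

lemma chowH_mem_spanNotLE {S : Set α} (hS : M.IsFlat S) (h : ¬ S ⊆ F) :
    chowH M S ∈ spanNotLE M F := Submodule.subset_span (mem_image_of_mem _ ⟨hS, h⟩)

lemma chowX_mem_spanNotLE {H : M.ProperFlat} (h : ¬ H.1 ⊆ F) : M.chowX H.1 ∈ spanNotLE M F := by
  have hsub : {S | M.IsFlat S ∧ H.1 ⊆ S} ⊆ {S | M.IsFlat S ∧ ¬ S ⊆ F} := fun _ hS ↦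
    ⟨hS.1, fun hSF ↦ h (hS.2.trans hSF)⟩
  exact Submodule.span_mono (image_mono hsub) (chowX_mem_span_chowH M H)

lemma subsetCount_replicate_of_not_subset (a : ℕ) (h : ¬ G ⊆ F) :
    subsetCount (Multiset.replicate a G) F = 0 :=
  Nat.eq_zero_of_not_pos fun hpos ↦ by
    obtain ⟨S, hS, hSF⟩ := subsetCount_pos.1 hpos
    exact h (Multiset.eq_of_mem_replicate hS ▸ hSF)

/-- The factor `x_F h_G ^ (rk G - rk F - 1)` passes from the interval below `F` to that
below `G`. -/
lemma IsTestClass.replicate_add {H : M.ProperFlat} (h : IsTestClass M H.1 s u) (hG : M.IsFlat G)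
    (hHG : H.1 ⊂ G) (hs : ∀ K ∈ s, K ⊆ H.1) {a n : ℕ}
    (ha : a + n + 1 + natRk M H.1 = natRk M G) :
    IsTestClass M G (Multiset.replicate a G + s) (u * (M.chowX H.1 * chowH M G ^ n)) where
  mul_eq := by
    have hHE : H.1 ≠ M.E := H.2.2
    have hpow := chowXTop_mul_pow_mul_chowX H.2.1 hG hHG ha
    have heq := h.mul_eq
    rw [chowXTop, if_neg hHE] at heq
    rw [← hpow, ← heq, chowHProd_add, chowHProd_replicate]
    ring
  exists_mem_chowGr := by
    obtain ⟨m, hm, hcard⟩ := h.exists_mem_chowGr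
    refine ⟨m + (1 + n), M.chowGr_mul_mem rfl hm
      (M.chowGr_mul_mem rfl (chowX_mem_chowGr M _) (chowH_pow_mem_chowGr M G n)), ?_⟩
    rw [Multiset.card_add, Multiset.card_replicate]
    omega
  exists_eq_mul K hK hKG := by
    replace hK : K ∈ s :=
      (Multiset.mem_add.1 hK).resolve_left fun h' ↦ hKG (Multiset.eq_of_mem_replicate h')
    have hKH := hs K hK
    have hGK : ¬ G ⊆ K := fun h' ↦ hHG.not_subset (h'.trans hKH)
    have hG' := Submodule.pow_mem_pow _ (chowH_mem_spanNotLE hG hGK) n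
    rw [subsetCount_add, subsetCount_replicate_of_not_subset a hGK, Multiset.card_add,
      Multiset.card_replicate]
    rcases eq_or_ne K H.1 with rfl | hne
    · have hall : subsetCount s H.1 = s.card := by
        classical
        exact Multiset.countP_eq_card.2 hs
      exact ⟨n, chowH M G ^ n, u, by ring, hG', by omega⟩
    · obtain ⟨m, v, p, rfl, hv, hm⟩ := h.exists_eq_mul K hK hne
      have hHK : ¬ H.1 ⊆ K := fun h' ↦ hne (hKH.antisymm h')
      refine ⟨m + (1 + n), v * (M.chowX H.1 * chowH M G ^ n), p, by ring, ?_, by omega⟩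
      rw [pow_add, pow_add, pow_one]
      exact Submodule.mul_mem_mul hv (Submodule.mul_mem_mul (chowX_mem_spanNotLE hHK) hG')

lemma exists_mem_forall_mem_subset (hs : s ≠ 0) (hchain : ∀ F ∈ s, ∀ G ∈ s, F ⊆ G ∨ G ⊆ F) :
    ∃ F ∈ s, ∀ G ∈ s, G ⊆ F := by
  classical
  obtain ⟨F, hF⟩ := s.toFinset.exists_maximal (Multiset.toFinset_nonempty.2 hs)
  simp only [Multiset.mem_toFinset] at hF
  exact ⟨F, hF.prop, fun G hG ↦ (hchain F hF.prop G hG).elim (hF.le_of_ge hG) id⟩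

lemma Standard.exists_isTestClass (hs : Standard M s) (hG : M.IsFlat G) (hsG : ∀ F ∈ s, F ⊆ G) :
    ∃ u, IsTestClass M G s u := by
  classical
  induction hn : natRk M G using Nat.strong_induction_on generalizing G s with
  | _ n ih =>
  obtain ⟨t, hst, ht⟩ : ∃ t, s = Multiset.replicate (s.count G) G + t ∧ ∀ F ∈ t, F ≠ G :=
    ⟨s.filter (· ≠ G), by rw [← Multiset.filter_eq', Multiset.filter_add_not],
      fun F hF ↦ (Multiset.mem_filter.1 hF).2⟩
  have hle : t ≤ s := hst ▸ Multiset.le_add_left _ _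
  rcases eq_or_ne t 0 with rfl | ht0
  · have hcount : s.count G ≤ natRk M G := by
      by_cases hGs : G ∈ s
      · exact hs.count_le G hGs
      · exact (Multiset.count_eq_zero.2 hGs).trans_le (Nat.zero_le _)
    rw [hst, add_zero]
    exact ⟨_, isTestClass_replicate hcount⟩
  · obtain ⟨F, hF, hmax⟩ := exists_mem_forall_mem_subset ht0 (hs.of_le hle).chain
    have hFs := Multiset.mem_of_le hle hF
    have hFG : F ⊂ G := (hsG F hFs).ssubset_of_ne (ht F hF)
    have hrk : natRk M F < natRk M G :=
      natRk_lt_of_ssubset (hs.isFlat F hFs) hFG hG.subset_ground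
    have hcount : s.count G + natRk M F < natRk M G := by
      by_cases hGs : G ∈ s
      · exact hs.count_lt G hGs F hFs hFG
      · rwa [Multiset.count_eq_zero.2 hGs, zero_add]
    obtain ⟨u, hu⟩ := ih (natRk M F) (hn ▸ hrk) (hs.of_le hle) (hs.isFlat F hFs) hmax rfl
    let H : M.ProperFlat := ⟨F, hs.isFlat F hFs, fun h ↦ hFG.not_subset (h ▸ hG.subset_ground)⟩
    have htest := IsTestClass.replicate_add (H := H) hu hG hFG hmax (a := s.count G)
      (n := natRk M G - natRk M F - 1 - s.count G) (by simp only [H]; omega)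
    rw [hst.symm] at htest
    exact ⟨_, htest⟩

end TestClasses

section PoincareDuality

variable {M : Matroid α} [M.Finite] [M.Loopless] {F : Set α} {s t : Multiset (Set α)}
  {u : M.AugChow}

lemma chowDeg_chowH_ground_pow (M : Matroid α) [M.Finite] [M.Loopless] :
    chowDeg M (chowH M M.E ^ M.natRank) = 1 := by
  rw [← chowHProd_replicate, chowDeg_chowHProd fun S hS ↦
    Multiset.eq_of_mem_replicate hS ▸ M.ground_isFlat, if_pos]
  refine ⟨Multiset.card_replicate _ _, fun G hG ↦ ?_⟩
  by_cases h : M.E ⊆ G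
  · rw [hG.subset_ground.antisymm h, natRk_ground]
    exact (subsetCount_le_card _ _).trans_eq (Multiset.card_replicate _ _)
  · rw [subsetCount_replicate_of_not_subset _ h]
    exact Nat.zero_le _

namespace IsTestClass

lemma chowDeg_mul_eq_one (h : IsTestClass M M.E s u) : chowDeg M (chowHProd M s * u) = 1 := by
  have heq := h.mul_eq
  rw [chowXTop, if_pos rfl, one_mul, one_mul, natRk_ground] at heq
  rw [heq, chowDeg_chowH_ground_pow]

lemma card_eq (h : IsTestClass M M.E s u) (hne : chowDeg M (chowHProd M t * u) ≠ 0) :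
    t.card = s.card := by
  obtain ⟨n, hn, hcard⟩ := h.exists_mem_chowGr
  by_contra hts
  refine hne (chowDeg_eq_zero_of_mem_chowGr (fun h' ↦ hts ?_)
    (M.chowGr_mul_mem rfl (chowHProd_mem_chowGr M t) hn))
  rw [natRk_ground] at hcard
  omega

lemma subsetCount_le (h : IsTestClass M M.E s u) (ht : ∀ S ∈ t, M.IsFlat S)
    (hne : chowDeg M (chowHProd M t * u) ≠ 0) (hF : F ∈ s) :
    subsetCount s F ≤ subsetCount t F := by
  classical
  have hcard := h.card_eq hne
  rcases eq_or_ne F M.E with rfl | hFE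
  · have hall : subsetCount t M.E = t.card :=
      Multiset.countP_eq_card.2 fun S hS ↦ (ht S hS).subset_ground
    rw [hall, hcard]
    exact subsetCount_le_card s _
  obtain ⟨m, v, p, rfl, hv, hm⟩ := h.exists_eq_mul F hF hFE
  let t' := t.filter (¬ · ⊆ F)
  have hsplit : chowHProd M t = chowHProd M (t.filter (· ⊆ F)) * chowHProd M t' := by
    rw [← chowHProd_add, Multiset.filter_add_not]
  have hcard' : subsetCount t F + t'.card = t.card := by
    rw [subsetCount, Multiset.countP_eq_card_filter, ← Multiset.card_add, Multiset.filter_add_not]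
  have hmem : chowHProd M t' ∈ spanNotLE M F ^ t'.card := chowHProd_mem_pow M fun S hS ↦
    chowH_mem_spanNotLE (ht S (Multiset.mem_filter.1 hS).1) (Multiset.mem_filter.1 hS).2
  by_contra hlt
  rw [natRk_ground] at hm
  refine hne ?_
  rw [hsplit, show ∀ a b x : M.AugChow, a * b * (x * v * p) = x * (b * v) * (a * p) by intros; ring]
  refine chowDeg_chowX_mul_eq_zero_of_mem_spanNotLE_pow (n := t'.card + m) (by omega) ?_ _
  rw [pow_add]
  exact Submodule.mul_mem_mul hmem hv

end IsTestClass

/-- **Poincaré duality**: among the standard products that occur in `z`, take one whose rank sum is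
smallest; its test class detects no other one. -/
theorem eq_zero_of_forall_chowDeg {z : M.AugChow} (h : ∀ a, chowDeg M (z * a) = 0) : z = 0 := by
  have hz : z ∈ Submodule.span ℚ (chowHProd M '' {s | Standard M s}) := by
    rw [span_chowHProd_standard]
    trivial
  obtain ⟨c, hc, rfl⟩ := (Finsupp.mem_span_image_iff_linearCombination ℚ).1 hz
  rw [Finsupp.mem_supported] at hc
  rcases c.support.eq_empty_or_nonempty with h0 | hne
  · rw [Finsupp.support_eq_empty.1 h0, map_zero]
  obtain ⟨s, hs, hmin⟩ := Finset.exists_min_image c.support (rankSum M) hne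
  have hstd : Standard M s := hc hs
  obtain ⟨u, hu⟩ := hstd.exists_isTestClass M.ground_isFlat fun F hF ↦
    (hstd.isFlat F hF).subset_ground
  have hother : ∀ t ∈ c.support, t ≠ s → chowDeg M (chowHProd M t * u) = 0 := by
    intro t ht hts
    have hstd' : Standard M t := hc ht
    by_contra hcon
    have hrel := rel_subset_of_subsetCount_le hstd.chain (hu.card_eq hcon) fun F hF ↦
      hu.subsetCount_le hstd'.isFlat hcon hF
    exact hts (eq_of_rel_of_rankSum_le hrel hstd'.isFlat
      (fun F hF ↦ (hstd.isFlat F hF).subset_ground) (hmin t ht))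
  have hsum := h u
  rw [Finsupp.linearCombination_apply, Finsupp.sum, Finset.sum_mul, map_sum,
    Finset.sum_eq_single_of_mem s hs fun t ht hts ↦ by
      rw [smul_mul_assoc, map_smul, hother t ht hts, smul_zero],
    smul_mul_assoc, map_smul, hu.chowDeg_mul_eq_one, smul_eq_mul, mul_one] at hsum
  exact absurd hsum (Finsupp.mem_support_iff.1 hs)

end PoincareDuality

section FlagMonomials

variable {M : Matroid α} [M.Finite] {G S : Set α} {𝓕 : Finset M.ProperFlat}

lemma chowH_pow_mul_chowH_singleton_mul_pow (hS : S ⊆ M.E) {e : α} (he : e ∈ M.E) {k n : ℕ}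
    (h : natRk M S ≤ k + n) :
    chowH M S ^ k * chowH M {e} * chowH M (insert e S) ^ n =
      chowH M (insert e S) ^ (k + n + 1) := by
  have hE : insert e S ⊆ M.E := insert_subset he hS
  have hrk := natRk_insert_le M e S
  induction k generalizing n with
  | zero =>
    have hadd := natRk_inter_add_union_le M {e} S
    rw [singleton_union] at hadd
    rw [pow_zero, one_mul, zero_add,
      chowH_mul_chowH_pow (singleton_subset_iff.2 (mem_insert e S)) hE (by omega)]
  | succ k ih =>
    have hrel := chowH_mul_chowH hS (singleton_subset_iff.2 he)
    rw [union_singleton, chowH_closure hE] at hrel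
    have h₁ := chowH_pow_mul_chowH_pow (subset_insert e S) hE (k + 1) (n := n + 1) (by omega)
    have h₂ := chowH_pow_mul_chowH_pow (subset_insert e S) hE k (n := n + 2) (by omega)
    have h₃ := ih (n := n + 1) (by omega)
    linear_combination (chowH M S ^ k * chowH M (insert e S) ^ n) * hrel + h₁ - h₂ + h₃

lemma prod_chowY (I : Finset ↥M.E) :
    ∏ e ∈ I, M.chowY e = chowH M (Subtype.val '' (I : Set ↥M.E)) ^ I.card := by
  classical
  induction I using Finset.induction with
  | empty => simp only [Finset.prod_empty, Finset.card_empty, pow_zero]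
  | insert e I he ih =>
    have hrk : natRk M (Subtype.val '' (I : Set ↥M.E)) ≤ I.card := by
      rw [← Nat.cast_le (α := ℕ∞), coe_natRk, ← encard_coe_eq_coe_finsetCard]
      exact (M.eRk_le_encard _).trans (encard_image_le _ _)
    have h := chowH_pow_mul_chowH_singleton_mul_pow (Subtype.coe_image_subset _ _) e.2
      (hrk.trans_eq (add_zero _).symm)
    rw [pow_zero, mul_one, add_zero] at h
    rw [Finset.prod_insert he, Finset.card_insert_of_notMem he, Finset.coe_insert,
      image_insert_eq, ih, ← h, chowH_singleton, mul_comm]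

lemma card_flag_add_natRk_le (hG : G ⊆ M.E) (hflag : ∀ F ∈ 𝓕, ∀ F' ∈ 𝓕, F.1 ⊆ F'.1 ∨ F'.1 ⊆ F.1)
    (h : ∀ F ∈ 𝓕, S ⊆ F.1 ∧ F.1 ⊂ G) (hSG : S ⊆ G) : 𝓕.card + natRk M S ≤ natRk M G := by
  have hmaps : ∀ F ∈ 𝓕, natRk M F.1 ∈ Finset.Ico (natRk M S) (natRk M G) := fun F hF ↦
    Finset.mem_Ico.2 ⟨natRk_mono M (h F hF).1, natRk_lt_of_ssubset F.2.1 (h F hF).2 hG⟩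
  have hinj : Set.InjOn (fun F : M.ProperFlat ↦ natRk M F.1) 𝓕 := by
    intro F hF F' hF' heq
    rcases hflag F hF F' hF' with hle | hle
    · exact Subtype.ext (eq_of_subset_of_natRk_le F.2.1 hle F'.2.1.subset_ground heq.ge)
    · exact Subtype.ext (eq_of_subset_of_natRk_le F'.2.1 hle F.2.1.subset_ground heq.le).symm
  have hcard := Finset.card_le_card_of_injOn _ hmaps hinj
  have hmono := natRk_mono M hSG
  rw [Nat.card_Ico] at hcard
  omega

lemma exists_mem_forall_erase_ssubset [DecidableEq M.ProperFlat] (h𝓕 : 𝓕.Nonempty)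
    (hflag : ∀ F ∈ 𝓕, ∀ F' ∈ 𝓕, F.1 ⊆ F'.1 ∨ F'.1 ⊆ F.1) :
    ∃ F ∈ 𝓕, ∀ F' ∈ 𝓕.erase F, F'.1 ⊂ F.1 := by
  obtain ⟨F, hF, hmax⟩ := 𝓕.exists_max_image (fun F ↦ natRk M F.1) h𝓕
  refine ⟨F, hF, fun F' hF' ↦ ?_⟩
  obtain ⟨hne, hF'⟩ := Finset.mem_erase.1 hF'
  have hle : F'.1 ⊆ F.1 := (hflag F' hF' F hF).elim id fun hle ↦
    (eq_of_subset_of_natRk_le F.2.1 hle F'.2.1.subset_ground (hmax F' hF')).symm.subset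
  exact hle.ssubset_of_ne fun heq ↦ hne (Subtype.ext heq)

lemma chowXTop_mul_prod_flag (hG : M.IsFlat G)
    (hflag : ∀ F ∈ 𝓕, ∀ F' ∈ 𝓕, F.1 ⊆ F'.1 ∨ F'.1 ⊆ F.1)
    (h : ∀ F ∈ 𝓕, S ⊆ F.1 ∧ F.1 ⊂ G) (hSG : S ⊆ G) (hcard : 𝓕.card + natRk M S = natRk M G) :
    chowXTop M G * (chowH M S ^ natRk M S * ∏ F ∈ 𝓕, M.chowX F.1) =
      chowXTop M G * chowH M G ^ natRk M G := by
  classical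
  induction hn : 𝓕.card generalizing 𝓕 G with
  | zero =>
    rw [Finset.card_eq_zero] at hn
    subst hn
    have hSE := hSG.trans hG.subset_ground
    rw [Finset.card_empty, zero_add] at hcard
    have hcl : M.closure S = G := eq_of_subset_of_natRk_le (M.isFlat_closure S)
      ((closure_subset_iff hG hSE).2 hSG) hG.subset_ground (by rw [natRk_closure, hcard])
    rw [Finset.prod_empty, mul_one, ← hcl, natRk_closure, chowH_closure hSE]
  | succ n ih =>
    obtain ⟨F, hF, hlt⟩ := exists_mem_forall_erase_ssubset (Finset.card_pos.1 (by omega)) hflag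
    obtain ⟨hSF, hFG⟩ := h F hF
    have hflag' : ∀ F' ∈ 𝓕.erase F, ∀ K ∈ 𝓕.erase F, F'.1 ⊆ K.1 ∨ K.1 ⊆ F'.1 :=
      fun F' hF' K hK ↦ hflag F' (Finset.mem_of_mem_erase hF') K (Finset.mem_of_mem_erase hK)
    have h' : ∀ F' ∈ 𝓕.erase F, S ⊆ F'.1 ∧ F'.1 ⊂ F.1 := fun F' hF' ↦
      ⟨(h F' (Finset.mem_of_mem_erase hF')).1, hlt F' hF'⟩
    have hcard' := Finset.card_erase_add_one hF
    have hle := card_flag_add_natRk_le F.2.1.subset_ground hflag' h' hSF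
    have hrk := natRk_lt_of_ssubset F.2.1 hFG hG.subset_ground
    have hbelow := ih F.2.1 hflag' h' hSF (by omega) (by omega)
    rw [chowXTop, if_neg F.2.2] at hbelow
    have htop := chowXTop_mul_pow_mul_chowX (n := 0) F.2.1 hG hFG (by omega)
    rw [pow_zero, mul_one, ← hbelow] at htop
    rw [← htop, ← Finset.mul_prod_erase 𝓕 _ hF]
    ring

end FlagMonomials

section DegreeMap

variable {M : Matroid α} [M.Finite]

lemma exists_algebraMap_of_mem_chowGr_zero {z : M.AugChow} (hz : z ∈ M.chowGr 0) :
    ∃ c : ℚ, algebraMap ℚ M.AugChow c = z := by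
  rw [← chowGr_one_pow, pow_zero] at hz
  exact Submodule.mem_one.1 hz

lemma exists_compatiblePair_empty (M : Matroid α) [M.Finite] : ∃ I : Finset ↥M.E,
    I.card + (∅ : Finset M.ProperFlat).card = M.natRank ∧ M.CompatiblePair I ∅ := by
  obtain ⟨B, hB⟩ := M.exists_isBase
  have := M.ground_finite.to_subtype
  lift B to Set ↥M.E using hB.subset_ground
  obtain ⟨I, rfl⟩ := B.toFinite.exists_finset_coe
  refine ⟨I, ?_, hB.indep, by simp only [Finset.notMem_empty, false_implies, implies_true],
    by simp only [Finset.notMem_empty, false_implies, implies_true]⟩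
  have hrk := natRk_of_indep hB.indep
  rw [ncard_image_of_injective _ Subtype.val_injective, ncard_coe_finset, natRk,
    hB.eRk_eq_eRank] at hrk
  rw [Finset.card_empty, add_zero, natRank, hrk]

variable (M) [M.Loopless]

/-- The degree map of `CH(M)`. -/
def degMap : M.chowGr M.natRank →ₗ[ℚ] ℚ := (chowDeg M).domRestrict _

theorem isDegreeMap_degMap : M.IsDegreeMap (degMap M) := by
  intro I 𝓕 h hI
  have hrk : natRk M (Subtype.val '' (I : Set ↥M.E)) = I.card := by
    rw [natRk_of_indep hI.indep, ncard_image_of_injective _ Subtype.val_injective,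
      ncard_coe_finset]
  have hprod := chowXTop_mul_prod_flag M.ground_isFlat hI.flag
    (fun F hF ↦ ⟨image_subset_iff.2 fun e he ↦ hI.compatible e he F hF,
      F.2.1.subset_ground.ssubset_of_ne F.2.2⟩)
    (Subtype.coe_image_subset _ _) (by rw [hrk, natRk_ground, add_comm, h])
  rw [chowXTop, if_pos rfl, one_mul, one_mul, hrk, ← prod_chowY, natRk_ground] at hprod
  exact (congrArg (chowDeg M) hprod).trans (chowDeg_chowH_ground_pow M)

variable {M}

lemma eq_zero_of_mem_chowGr {k : ℕ} (hk : M.natRank < k) {z : M.AugChow}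
    (hz : z ∈ M.chowGr k) : z = 0 := by
  refine eq_zero_of_forall_chowDeg fun a ↦ ?_
  induction a using chowGr_induction with
  | mem l a ha => exact chowDeg_eq_zero_of_mem_chowGr (by omega) (M.chowGr_mul_mem rfl hz ha)
  | add a b ha hb => rw [mul_add, map_add, ha, hb, add_zero]

lemma eq_smul_of_mem_chowGr_natRank {z : M.AugChow} (hz : z ∈ M.chowGr M.natRank) :
    z = chowDeg M z • chowH M M.E ^ M.natRank := by
  have htop := chowH_pow_mem_chowGr M M.E M.natRank
  have hmem := sub_mem hz (Submodule.smul_mem _ (chowDeg M z) htop)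
  refine sub_eq_zero.1 (eq_zero_of_forall_chowDeg fun a ↦ ?_)
  induction a using chowGr_induction with
  | mem k a ha =>
    rcases k.eq_zero_or_pos with rfl | hk
    · obtain ⟨c, rfl⟩ := exists_algebraMap_of_mem_chowGr_zero ha
      rw [mul_comm, ← Algebra.smul_def, map_smul, map_sub, map_smul, chowDeg_chowH_ground_pow,
        smul_eq_mul, smul_eq_mul, mul_one, sub_self, mul_zero]
    · exact chowDeg_eq_zero_of_mem_chowGr (by omega) (M.chowGr_mul_mem rfl hmem ha)
  | add a b ha hb => rw [mul_add, map_add, ha, hb, add_zero]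

theorem eq_degMap_of_isDegreeMap {deg : M.chowGr M.natRank →ₗ[ℚ] ℚ} (h : M.IsDegreeMap deg) :
    deg = degMap M := by
  obtain ⟨I, hcard, hI⟩ := exists_compatiblePair_empty M
  let top : M.chowGr M.natRank := ⟨_, chowH_pow_mem_chowGr M M.E M.natRank⟩
  have hspan (z : M.chowGr M.natRank) : z = degMap M z • top :=
    Subtype.ext (eq_smul_of_mem_chowGr_natRank z.2)
  have hdeg : deg top = 1 := by
    have h₁ := h I ∅ hcard hI
    rwa [hspan ⟨_, M.chowMonomial_mem I ∅ hcard⟩, isDegreeMap_degMap M I ∅ hcard hI,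
      one_smul] at h₁
  ext z
  conv_lhs => rw [hspan z, map_smul, hdeg, smul_eq_mul, mul_one]

end DegreeMap

section Theta

variable (M : Matroid α) [M.Finite] (i : α) {F S : Set α}

open Classical in
lemma sum_chowX_of_eq (S : Set α) : ∑ G : M.ProperFlat with G.1 = S, M.chowX G.1 = M.chowX S := by
  by_cases hS : M.IsFlat S ∧ S ≠ M.E
  · let F : M.ProperFlat := ⟨S, hS⟩
    exact Finset.sum_eq_single_of_mem F ((Finset.mem_filter_univ F).2 rfl) fun G hG hne ↦
      absurd (Subtype.ext ((Finset.mem_filter_univ G).1 hG)) hne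
  · rw [M.chowX_of_not hS]
    exact Finset.sum_eq_zero fun G hG ↦ absurd ((Finset.mem_filter_univ _).1 hG ▸ G.2) hS

variable {i}

open Classical in
lemma sum_chowX_of_sdiff_eq (hi : i ∉ F) :
    ∑ G : M.ProperFlat with G.1 \ {i} = F, M.chowX G.1 = M.chowX F + M.chowX (insert i F) := by
  have hiff (G : M.ProperFlat) : G.1 \ {i} = F ↔ G.1 = F ∨ G.1 = insert i F := by
    constructor
    · rintro rfl
      by_cases hG : i ∈ G.1
      · exact Or.inr (insert_sdiff_self_of_mem hG).symm
      · exact Or.inl (sdiff_singleton_eq_self hG).symm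
    · rintro (h | h)
      · rw [h, sdiff_singleton_eq_self hi]
      · rw [h, insert_sdiff_self_of_notMem hi]
  simp only [hiff]
  rw [Finset.filter_or, Finset.sum_union, sum_chowX_of_eq, sum_chowX_of_eq]
  refine Finset.disjoint_filter.2 fun G _ h h' ↦ hi ?_
  rw [← h, h']
  exact mem_insert i F

variable {M} in
lemma theta_chowX (hF : (M ＼ {i}).IsFlat F) (hne : F ≠ M.E \ {i}) :
    M.theta i ((M ＼ {i}).chowX F) = M.chowX F + M.chowX (insert i F) := by
  rw [(M ＼ {i}).chowX_eq ⟨F, hF, hne⟩]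
  exact aeval_X (M.thetaVar i) _

variable {M}

lemma theta_chowH (hS : S ⊆ M.E \ {i}) : M.theta i (chowH (M ＼ {i}) S) = chowH M S := by
  classical
  have hsub (G : Set α) : S ⊆ G \ {i} ↔ S ⊆ G :=
    ⟨fun h ↦ h.trans sdiff_subset, fun h ↦ subset_sdiff_singleton h fun hi ↦ (hS hi).2 rfl⟩
  calc M.theta i (chowH (M ＼ {i}) S)
      = ∑ F : (M ＼ {i}).ProperFlat with ¬ S ⊆ F.1,
          ∑ G : M.ProperFlat with G.1 \ {i} = F.1, M.chowX G.1 := by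
        rw [chowH, map_sum]
        exact Finset.sum_congr rfl fun F _ ↦ by
          rw [theta_chowX F.2.1 F.2.2, sum_chowX_of_sdiff_eq M F.notMem]
    _ = ∑ G : M.ProperFlat with ¬ S ⊆ G.1,
          ∑ F : (M ＼ {i}).ProperFlat with G.1 \ {i} = F.1, M.chowX G.1 := by
        refine Finset.sum_comm' fun F G ↦ ?_
        simp only [Finset.mem_filter_univ]
        rw [and_comm]
        exact and_congr_right fun h ↦ by rw [← h, hsub]
    _ = chowH M S := by
        refine Finset.sum_congr rfl fun G hG ↦ ?_
        rw [Finset.mem_filter_univ] at hG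
        have hne : G.1 \ {i} ≠ M.E \ {i} := fun h ↦ hG ((hsub _).1 (hS.trans h.symm.subset))
        refine Finset.sum_eq_single_of_mem ⟨G.1 \ {i}, G.2.1.delete i, hne⟩
          ((Finset.mem_filter_univ _).2 rfl) fun F hF hFG ↦ absurd (Subtype.ext ?_) hFG
        exact ((Finset.mem_filter_univ _).1 hF).symm

lemma theta_chowHProd {s : Multiset (Set α)} (hs : ∀ S ∈ s, (M ＼ {i}).IsFlat S) :
    M.theta i (chowHProd (M ＼ {i}) s) = chowHProd M (s.map M.closure) := by
  induction s using Multiset.induction_on with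
  | empty => rw [Multiset.map_zero, chowHProd_zero, chowHProd_zero, map_one]
  | cons S s ih =>
    rw [Multiset.forall_mem_cons] at hs
    have hS : S ⊆ M.E \ {i} := hs.1.subset_ground
    rw [chowHProd_cons, map_mul, Multiset.map_cons, chowHProd_cons, ih hs.2, theta_chowH hS,
      chowH_closure (hS.trans sdiff_subset)]

lemma theta_mem_chowGr {k : ℕ} {a : (M ＼ {i}).AugChow} (ha : a ∈ (M ＼ {i}).chowGr k) :
    M.theta i a ∈ M.chowGr k := by
  refine Submodule.span_le (p := (M.chowGr k).comap (M.theta i).toLinearMap) |>.2 ?_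
    (chowGr_le_span_chowHProd _ k ha)
  rintro _ ⟨s, ⟨rfl, hs⟩, rfl⟩
  rw [SetLike.mem_coe, Submodule.mem_comap, AlgHom.toLinearMap_apply, theta_chowHProd hs,
    ← Multiset.card_map M.closure s]
  exact chowHProd_mem_chowGr M _

lemma smul_eq_theta_mul (r : (M ＼ {i}).AugChow) (z : M.AugChow) : r • z = M.theta i r * z :=
  Algebra.smul_def r z

lemma theta_mem_span_chowHProd (r : (M ＼ {i}).AugChow) : M.theta i r ∈ Submodule.span ℚ
    (chowHProd M '' {s | ∀ S ∈ s, ∃ T ⊆ M.E \ {i}, M.closure T = S}) := by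
  have hr : r ∈ Submodule.span ℚ (chowHProd (M ＼ {i}) '' {s | ∀ S ∈ s, (M ＼ {i}).IsFlat S}) := by
    rw [span_chowHProd_isFlat]
    trivial
  have hmap := Submodule.mem_map_of_mem (f := (M.theta i).toLinearMap) hr
  rw [Submodule.map_span] at hmap
  refine Submodule.span_mono ?_ hmap
  rintro _ ⟨_, ⟨s, hs, rfl⟩, rfl⟩
  refine ⟨s.map M.closure, fun S hS ↦ ?_, (theta_chowHProd hs).symm⟩
  obtain ⟨T, hT, rfl⟩ := Multiset.mem_map.1 hS
  exact ⟨T, (hs T hT).subset_ground, rfl⟩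

omit [M.Finite] in
lemma notMem_of_mem_deletionFlats (hF : F ∈ M.deletionFlats i) : i ∉ F :=
  fun h ↦ (hF.1.subset h).2 rfl

variable [M.Loopless]

lemma chowDeg_chowX_insert_mul_theta (hF : F ∈ M.deletionFlats i) (r : (M ＼ {i}).AugChow) :
    chowDeg M (M.chowX (insert i F) * M.theta i r) = 0 := by
  classical
  have hiF := notMem_of_mem_deletionFlats hF
  obtain ⟨-, hF, hF'⟩ := hF
  rw [mul_comm]
  refine chowDeg_mul_eq_zero_of_mem_span ?_ (theta_mem_span_chowHProd r)
  rintro _ ⟨s, hs, rfl⟩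
  rw [mul_comm]
  by_contra h
  obtain ⟨-, hle, heq⟩ := subsetCount_of_chowDeg_chowX_mul_ne_zero (fun S hS ↦ by
    obtain ⟨T, -, rfl⟩ := hs S hS
    exact M.isFlat_closure T) h
  have hcount : subsetCount s (insert i F) = subsetCount s F := by
    refine Multiset.countP_congr rfl fun S hS ↦ ?_
    obtain ⟨T, hT, rfl⟩ := hs S hS
    have hTE : T ⊆ M.E := hT.trans sdiff_subset
    rw [closure_subset_iff hF hTE, closure_subset_iff hF' hTE,
      subset_insert_iff_of_notMem fun hi ↦ (hT hi).2 rfl]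
  have hF_le := hle F hF
  have hlt := natRk_lt_of_ssubset hF (ssubset_insert hiF) hF'.subset_ground
  omega

lemma isFlat_sdiff_of_isColoop {M : Matroid α} (h : M.IsColoop i) : M.IsFlat (M.E \ {i}) := by
  rw [isFlat_iff_closure_eq]
  refine subset_antisymm (fun x hx ↦ ⟨M.closure_subset_ground _ hx, ?_⟩)
    (M.subset_closure _ sdiff_subset)
  rintro rfl
  exact (isColoop_iff_notMem_closure_compl h.mem_ground).1 h hx

lemma chowDeg_theta_of_isColoop (h : M.IsColoop i) (r : (M ＼ {i}).AugChow) :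
    chowDeg M (M.theta i r) = 0 := by
  classical
  have hflat := isFlat_sdiff_of_isColoop h
  rw [← mul_one (M.theta i r)]
  refine chowDeg_mul_eq_zero_of_mem_span ?_ (theta_mem_span_chowHProd r)
  rintro _ ⟨s, hs, rfl⟩
  rw [mul_one, chowDeg_chowHProd fun S hS ↦ ?_, if_neg fun hrado ↦ ?_]
  · have hall : subsetCount s (M.E \ {i}) = s.card := Multiset.countP_eq_card.2 fun S hS ↦ by
      obtain ⟨T, hT, rfl⟩ := hs S hS
      exact (closure_subset_iff hflat (hT.trans sdiff_subset)).2 hT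
    have hcard := hrado.card_eq
    have hle := hrado.subsetCount_le _ hflat
    have hlt := natRk_lt_of_ssubset hflat (sdiff_singleton_ssubset.2 h.mem_ground) subset_rfl
    rw [natRk_ground] at hlt
    omega
  · obtain ⟨T, -, rfl⟩ := hs S hS
    exact M.isFlat_closure T

end Theta

section ProductsOfGenerators

variable {M : Matroid α} {i : α} {F G : Set α}

lemma isFlat_delete_of_notMem (hF : M.IsFlat F) (hi : i ∉ F) : (M ＼ {i}).IsFlat F := by
  have h := hF.delete i
  rwa [sdiff_singleton_eq_self hi] at h

variable [M.Finite]

lemma theta_chowX_of_isFlat (hF : M.IsFlat F) (h : F ⊂ M.E \ {i}) :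
    M.theta i ((M ＼ {i}).chowX F) = M.chowX F + M.chowX (insert i F) :=
  theta_chowX (isFlat_delete_of_notMem hF fun hi ↦ (h.subset hi).2 rfl) h.ne

lemma chowX_insert_mul_chowX_insert_of_ssubset (hG : G ∈ M.deletionFlats i) (h : F ⊂ G) :
    M.chowX (insert i F) * M.chowX (insert i G) =
      M.chowX (insert i F) * M.theta i ((M ＼ {i}).chowX G) := by
  have hiG := notMem_of_mem_deletionFlats hG
  rw [theta_chowX_of_isFlat hG.2.1 hG.1, mul_add,
    M.chowX_mul_chowX (fun h' ↦ hiG (h' (mem_insert i F)))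
      fun h' ↦ h.not_subset ((subset_insert_iff_of_notMem hiG).1 h'), zero_add]

lemma exists_chowX_insert_mul_chowX_insert_eq (hF : F ∈ M.deletionFlats i)
    (hG : G ∈ M.deletionFlats i) (h : F ≠ G) :
    ∃ H ∈ M.deletionFlats i, ∃ t, M.chowX (insert i F) * M.chowX (insert i G) =
      M.chowX (insert i H) * M.theta i t := by
  by_cases hFG : F ⊆ G
  · exact ⟨F, hF, _, chowX_insert_mul_chowX_insert_of_ssubset hG (hFG.ssubset_of_ne h)⟩
  by_cases hGF : G ⊆ F
  · exact ⟨G, hG, _, (mul_comm _ _).trans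
      (chowX_insert_mul_chowX_insert_of_ssubset hF (hGF.ssubset_of_ne h.symm))⟩
  · refine ⟨F, hF, 0, ?_⟩
    rw [map_zero, mul_zero]
    exact M.chowX_mul_chowX
      (fun h ↦ hFG ((insert_subset_insert_iff (notMem_of_mem_deletionFlats hF)).1 h))
      (fun h ↦ hGF ((insert_subset_insert_iff (notMem_of_mem_deletionFlats hG)).1 h))

lemma chowX_sdiff_mul_chowX (hi : i ∈ G) (hG : ¬ M.E \ {i} ⊆ G) :
    M.chowX (M.E \ {i}) * M.chowX G = 0 :=
  M.chowX_mul_chowX hG fun h ↦ (h hi).2 rfl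

lemma chowX_sdiff_mul_chowX_insert (hF : F ∈ M.deletionFlats i) :
    M.chowX (M.E \ {i}) * M.chowX (insert i F) = 0 :=
  chowX_sdiff_mul_chowX (mem_insert i F) fun h ↦
    hF.1.not_subset ((subset_insert_iff_of_notMem fun hi ↦ hi.2 rfl).1 h)

lemma chowH_ground_sub_chowH_sdiff (hi : i ∈ M.E) :
    chowH M M.E - chowH M (M.E \ {i}) = M.chowX (M.E \ {i}) := by
  classical
  have hiff (H : M.ProperFlat) : M.E \ {i} ⊆ H.1 ∧ ¬ M.E ⊆ H.1 ↔ H.1 = M.E \ {i} := by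
    rw [sdiff_singleton_subset_iff]
    constructor
    · rintro ⟨hsub, hnot⟩
      have hiH : i ∉ H.1 := fun h ↦ hnot (hsub.trans (insert_subset h subset_rfl))
      exact (subset_sdiff_singleton H.2.1.subset_ground hiH).antisymm
        (sdiff_singleton_subset_iff.2 hsub)
    · intro h
      rw [h]
      exact ⟨(insert_sdiff_self_of_mem hi).symm.subset, fun h' ↦ (h' hi).2 rfl⟩
  rw [chowH_sub M sdiff_subset, ← sum_chowX_of_eq M (M.E \ {i})]
  exact Finset.sum_congr (Finset.filter_congr fun H _ ↦ hiff H) fun _ _ ↦ rfl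

lemma chowX_sdiff_mul_chowH_ground (hi : i ∈ M.E) :
    M.chowX (M.E \ {i}) * chowH M M.E = 0 := by
  classical
  rw [← sub_add_cancel (chowH M M.E) (chowH M {i}), mul_add,
    chowX_mul_chowH_singleton hi fun h ↦ h.2 rfl, add_zero,
    chowH_sub M (singleton_subset_iff.2 hi), Finset.mul_sum]
  refine Finset.sum_eq_zero fun H hH ↦ ?_
  obtain ⟨hiH, hnot⟩ := (Finset.mem_filter_univ _).1 hH
  rw [singleton_subset_iff] at hiH
  refine chowX_sdiff_mul_chowX hiH fun h ↦ hnot ?_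
  rwa [sdiff_singleton_subset_iff, insert_eq_of_mem hiH] at h

lemma chowX_sdiff_mul_self (hi : i ∈ M.E) : M.chowX (M.E \ {i}) * M.chowX (M.E \ {i}) =
    M.chowX (M.E \ {i}) * M.theta i (-chowH (M ＼ {i}) (M.E \ {i})) := by
  have hsub := chowH_ground_sub_chowH_sdiff hi
  rw [map_neg, theta_chowH subset_rfl]
  linear_combination chowX_sdiff_mul_chowH_ground hi - M.chowX (M.E \ {i}) * hsub

lemma exists_theta_eq_chowX (hne : G ≠ M.E \ {i}) (h : G \ {i} ∉ M.deletionFlats i) :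
    ∃ r, M.theta i r = M.chowX G := by
  by_cases hG : M.IsFlat G ∧ G ≠ M.E
  swap
  · exact ⟨0, by rw [M.chowX_of_not hG, map_zero]⟩
  obtain ⟨hG, hGE⟩ := hG
  refine ⟨(M ＼ {i}).chowX (G \ {i}), ?_⟩
  by_cases hiG : i ∈ G
  · have hins : insert i (G \ {i}) = G := insert_sdiff_self_of_mem hiG
    have hne' : G \ {i} ≠ M.E \ {i} := fun h' ↦ hGE <| by
      rw [← hins, h', insert_sdiff_self_of_mem (hG.subset_ground hiG)]
    have hsub := (sdiff_subset_sdiff_left hG.subset_ground).ssubset_of_ne hne'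
    rw [theta_chowX (hG.delete i) hne', hins,
      M.chowX_of_not fun hF ↦ h ⟨hsub, hF.1, hins.symm ▸ hG⟩, zero_add]
  · have hsub := (subset_sdiff_singleton hG.subset_ground hiG).ssubset_of_ne hne
    rw [sdiff_singleton_eq_self hiG] at h ⊢
    rw [theta_chowX_of_isFlat hG hsub, M.chowX_of_not fun hF ↦ h ⟨hsub, hG, hF.1⟩, add_zero]

end ProductsOfGenerators

section SumOfSummands

variable (M : Matroid α) [M.Finite] (i : α)

/-- The generators of the summands as `CH(M ＼ i)`-modules, indexed like the summands. -/
def summandGen : Fin 2 ⊕ ↥(M.deletionFlats i) → M.AugChow :=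
  Sum.elim ![1, M.chowX (M.E \ {i})] (fun F ↦ M.chowX (insert i F.1))

lemma mulChowImage_eq_span (a : M.AugChow) :
    M.mulChowImage i a = Submodule.span (M ＼ {i}).AugChow {a} := by
  rw [mulChowImage, chowImage, ← LinearMap.range_comp, ← LinearMap.range_toSpanSingleton]
  exact congrArg LinearMap.range
    (LinearMap.ext fun r ↦ (mul_comm a _).trans (Algebra.smul_def r a).symm)

lemma chowImage_eq_span : M.chowImage i = Submodule.span (M ＼ {i}).AugChow {1} := by
  rw [← mulChowImage_eq_span, mulChowImage, LinearMap.mulLeft_one, Submodule.map_id]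

lemma summandColoop_eq_span (p : Fin 2 ⊕ ↥(M.deletionFlats i)) :
    M.summandColoop i p = Submodule.span (M ＼ {i}).AugChow {summandGen M i p} := by
  rcases p with p | F
  · fin_cases p
    · exact chowImage_eq_span M i
    · exact mulChowImage_eq_span M i _
  · exact mulChowImage_eq_span M i _

variable {M i}

lemma mem_summandColoop {p : Fin 2 ⊕ ↥(M.deletionFlats i)} {z : M.AugChow} :
    z ∈ M.summandColoop i p ↔ ∃ r, z = summandGen M i p * M.theta i r := by
  rw [summandColoop_eq_span, Submodule.mem_span_singleton]
  simp only [smul_eq_theta_mul, mul_comm (summandGen M i p), eq_comm]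

variable (M i)

/-- The sum of all summands of the coloop case. -/
def summandSum : Submodule (M ＼ {i}).AugChow M.AugChow :=
  Submodule.span (M ＼ {i}).AugChow (range (summandGen M i))

variable {M i} {F G : Set α} {a : M.AugChow}

lemma mul_theta_mem_summandSum (ha : a ∈ summandSum M i) (r : (M ＼ {i}).AugChow) :
    a * M.theta i r ∈ summandSum M i := by
  rw [mul_comm, ← smul_eq_theta_mul]
  exact Submodule.smul_mem _ r ha

lemma one_mem_summandSum : 1 ∈ summandSum M i := Submodule.subset_span ⟨Sum.inl 0, rfl⟩

lemma theta_mem_summandSum (r : (M ＼ {i}).AugChow) : M.theta i r ∈ summandSum M i :=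
  one_mul (M.theta i r) ▸ mul_theta_mem_summandSum one_mem_summandSum r

lemma chowX_sdiff_mem_summandSum : M.chowX (M.E \ {i}) ∈ summandSum M i :=
  Submodule.subset_span ⟨Sum.inl 1, rfl⟩

lemma chowX_insert_mem_summandSum (hF : F ∈ M.deletionFlats i) :
    M.chowX (insert i F) ∈ summandSum M i :=
  Submodule.subset_span ⟨Sum.inr ⟨F, hF⟩, rfl⟩

lemma chowX_eq_theta_sub (hF : F ∈ M.deletionFlats i) :
    M.chowX F = M.theta i ((M ＼ {i}).chowX F) - M.chowX (insert i F) :=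
  eq_sub_of_add_eq (theta_chowX_of_isFlat hF.2.1 hF.1).symm

@[elab_as_elim]
lemma chowX_cases {motive : Set α → Prop} (sdiff : motive (M.E \ {i}))
    (theta : ∀ G r, M.theta i r = M.chowX G → motive G)
    (insert : ∀ F ∈ M.deletionFlats i, motive (insert i F))
    (deletionFlats : ∀ F ∈ M.deletionFlats i, motive F) (G : Set α) : motive G := by
  rcases eq_or_ne G (M.E \ {i}) with rfl | hne
  · exact sdiff
  by_cases h : G \ {i} ∈ M.deletionFlats i
  · by_cases hiG : i ∈ G
    · exact insert_sdiff_self_of_mem hiG ▸ insert _ h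
    · exact deletionFlats G (sdiff_singleton_eq_self hiG ▸ h)
  · obtain ⟨r, hr⟩ := exists_theta_eq_chowX hne h
    exact theta G r hr

lemma chowX_mem_summandSum (G : Set α) : M.chowX G ∈ summandSum M i := by
  induction G using chowX_cases (M := M) (i := i) with
  | sdiff => exact chowX_sdiff_mem_summandSum
  | theta G r hr => exact hr ▸ theta_mem_summandSum r
  | insert F hF => exact chowX_insert_mem_summandSum hF
  | deletionFlats F hF =>
    rw [chowX_eq_theta_sub hF]
    exact sub_mem (theta_mem_summandSum _) (chowX_insert_mem_summandSum hF)

lemma chowX_insert_mul_chowX_insert_mem_summandSum (hF : F ∈ M.deletionFlats i)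
    (hG : G ∈ M.deletionFlats i) (h : F ≠ G) :
    M.chowX (insert i F) * M.chowX (insert i G) ∈ summandSum M i := by
  obtain ⟨H, hH, t, ht⟩ := exists_chowX_insert_mul_chowX_insert_eq hF hG h
  exact ht ▸ mul_theta_mem_summandSum (chowX_insert_mem_summandSum hH) t

lemma chowX_mul_chowX_insert_mem_summandSum (hF : F ∈ M.deletionFlats i)
    (hG : G ∈ M.deletionFlats i) (h : F ≠ G) :
    M.chowX F * M.chowX (insert i G) ∈ summandSum M i := by
  rw [chowX_eq_theta_sub hF, sub_mul, mul_comm (M.theta i _)]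
  exact sub_mem (mul_theta_mem_summandSum (chowX_insert_mem_summandSum hG) _)
    (chowX_insert_mul_chowX_insert_mem_summandSum hF hG h)

lemma chowX_mul_chowX_mem_summandSum (hF : F ∈ M.deletionFlats i) :
    G ≠ F → G ≠ insert i F → M.chowX F * M.chowX G ∈ summandSum M i := by
  induction G using chowX_cases (M := M) (i := i) with
  | sdiff =>
    intro _ _
    rw [mul_comm, chowX_eq_theta_sub hF, mul_sub, chowX_sdiff_mul_chowX_insert hF, sub_zero]
    exact mul_theta_mem_summandSum chowX_sdiff_mem_summandSum _
  | theta G r hr => exact fun _ _ ↦ hr ▸ mul_theta_mem_summandSum (chowX_mem_summandSum F) r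
  | insert G hG =>
    exact fun _ hne ↦ chowX_mul_chowX_insert_mem_summandSum hF hG fun h ↦ hne (h ▸ rfl)
  | deletionFlats G hG =>
    intro hne _
    rw [chowX_eq_theta_sub hG, mul_sub]
    exact sub_mem (mul_theta_mem_summandSum (chowX_mem_summandSum F) _)
      (chowX_mul_chowX_insert_mem_summandSum hF hG hne.symm)

/-- For `f ∉ F ∪ i`, the relations `x_F y_i = x_F y_f = 0` say that `x_F ∑ x_G` is the same for the
flats `G` with `i ∈ G ∌ f` and for those with `f ∈ G ∌ i`; in this identity, `x_F x_{F ∪ i}` is the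
only term not covered by `chowX_mul_chowX_mem_summandSum`. -/
lemma chowX_mul_chowX_insert_self_mem_summandSum (hi : i ∈ M.E) (hF : F ∈ M.deletionFlats i) :
    M.chowX F * M.chowX (insert i F) ∈ summandSum M i := by
  classical
  obtain ⟨f, ⟨hfE, hfi⟩, hfF⟩ := exists_of_ssubset hF.1
  have hiF := notMem_of_mem_deletionFlats hF
  have hf : f ∉ insert i F := fun h ↦ h.elim hfi hfF
  let P : M.ProperFlat := ⟨insert i F, hF.2.2, fun h ↦ hf (h ▸ hfE)⟩
  have hi_sum := chowH_sub M (singleton_subset_iff.2 (mem_insert i {f}))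
  have hf_sum := chowH_sub M (subset_insert i {f})
  simp only [singleton_subset_iff, insert_subset_iff] at hi_sum hf_sum
  rw [← Finset.add_sum_erase _ _ (a := P) ((Finset.mem_filter_univ P).2
    ⟨mem_insert i F, fun h ↦ hf h.2⟩)] at hi_sum
  suffices h : M.chowX F * M.chowX (insert i F) =
      (∑ G : M.ProperFlat with f ∈ G.1 ∧ ¬ (i ∈ G.1 ∧ f ∈ G.1), M.chowX F * M.chowX G.1) -
        ∑ G ∈ (Finset.univ.filter fun G : M.ProperFlat ↦
          i ∈ G.1 ∧ ¬ (i ∈ G.1 ∧ f ∈ G.1)).erase P, M.chowX F * M.chowX G.1 by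
    rw [h]
    refine sub_mem (sum_mem fun G hG ↦ ?_) (sum_mem fun G hG ↦ ?_)
    · obtain ⟨hfG, hiG⟩ := (Finset.mem_filter_univ _).1 hG
      exact chowX_mul_chowX_mem_summandSum hF (fun h ↦ hfF (h ▸ hfG))
        fun h ↦ hiG ⟨h ▸ mem_insert i F, hfG⟩
    · obtain ⟨hGP, hG⟩ := Finset.mem_erase.1 hG
      exact chowX_mul_chowX_mem_summandSum hF
        (fun h ↦ hiF (h ▸ ((Finset.mem_filter_univ _).1 hG).1)) fun h ↦ hGP (Subtype.ext h)
  rw [← Finset.mul_sum, ← Finset.mul_sum, ← hf_sum]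
  linear_combination chowX_mul_chowH_singleton hfE hfF - chowX_mul_chowH_singleton hi hiF -
    M.chowX F * hi_sum

lemma chowX_insert_mul_self_mem_summandSum (hi : i ∈ M.E) (hF : F ∈ M.deletionFlats i) :
    M.chowX (insert i F) * M.chowX (insert i F) ∈ summandSum M i := by
  have heq : M.chowX (insert i F) * M.chowX (insert i F) =
      M.chowX (insert i F) * M.theta i ((M ＼ {i}).chowX F) -
        M.chowX F * M.chowX (insert i F) := by
    rw [theta_chowX_of_isFlat hF.2.1 hF.1]
    ring
  rw [heq]
  exact sub_mem (mul_theta_mem_summandSum (chowX_insert_mem_summandSum hF) _)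
    (chowX_mul_chowX_insert_self_mem_summandSum hi hF)

lemma summandGen_mul_summandGen_mem_summandSum (hi : i ∈ M.E)
    (p q : Fin 2 ⊕ ↥(M.deletionFlats i)) :
    summandGen M i p * summandGen M i q ∈ summandSum M i := by
  have hgen (q) : summandGen M i q ∈ summandSum M i := Submodule.subset_span ⟨q, rfl⟩
  have hone (q) : 1 * summandGen M i q ∈ summandSum M i :=
    (one_mul (summandGen M i q)).symm ▸ hgen q
  have hzero (F : ↥(M.deletionFlats i)) :
      M.chowX (M.E \ {i}) * M.chowX (insert i F.1) ∈ summandSum M i :=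
    (chowX_sdiff_mul_chowX_insert F.2).symm ▸ zero_mem _
  rcases p with p | F <;> rcases q with q | G
  · fin_cases p
    · exact hone _
    · fin_cases q
      · exact (mul_one (summandGen M i (Sum.inl 1))).symm ▸ hgen _
      · exact (chowX_sdiff_mul_self hi).symm ▸
          mul_theta_mem_summandSum chowX_sdiff_mem_summandSum _
  · fin_cases p
    · exact hone _
    · exact hzero G
  · rw [mul_comm]
    fin_cases q
    · exact hone _
    · exact hzero F
  · rcases eq_or_ne F G with rfl | hFG
    · exact chowX_insert_mul_self_mem_summandSum hi F.2
    · exact chowX_insert_mul_chowX_insert_mem_summandSum F.2 G.2 (Subtype.coe_injective.ne hFG)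

lemma summandSum_eq_top (hi : i ∈ M.E) : summandSum M i = ⊤ := by
  have hmul : summandSum M i * summandSum M i ≤ summandSum M i := by
    rw [summandSum, Submodule.span_mul_span, Submodule.span_le]
    rintro _ ⟨_, ⟨p, rfl⟩, _, ⟨q, rfl⟩, rfl⟩
    exact summandGen_mul_summandGen_mem_summandSum hi p q
  have hprod (s : Multiset (Set α)) : chowHProd M s ∈ summandSum M i := by
    induction s using Multiset.induction_on with
    | empty => exact chowHProd_zero (M := M) ▸ one_mem_summandSum
    | cons S s ih =>
      rw [chowHProd_cons]
      exact hmul (Submodule.mul_mem_mul (sum_mem fun F _ ↦ chowX_mem_summandSum F.1) ih)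
  refine Submodule.eq_top_iff'.2 fun z ↦ ?_
  have hz : z ∈ Submodule.span ℚ (chowHProd M '' {s | ∀ S ∈ s, M.IsFlat S}) := by
    rw [span_chowHProd_isFlat]
    trivial
  induction hz using Submodule.span_induction with
  | mem z hz =>
    obtain ⟨s, -, rfl⟩ := hz
    exact hprod s
  | zero => exact zero_mem _
  | add a b _ _ ha hb => exact add_mem ha hb
  | smul c a _ ha =>
    rw [Algebra.smul_def, mul_comm, ← AlgHom.commutes (M.theta i)]
    exact mul_theta_mem_summandSum ha _

lemma iSup_summandColoop (hi : i ∈ M.E) : ⨆ p, M.summandColoop i p = ⊤ := by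
  rw [← summandSum_eq_top hi, summandSum, Submodule.span_range_eq_iSup]
  simp only [summandColoop_eq_span]

end SumOfSummands

section Orthogonality

variable {M : Matroid α} [M.Finite] [M.Loopless] {i : α}
  {N N' : Submodule (M ＼ {i}).AugChow M.AugChow}

/-- The orthogonal complement of a `CH(M ＼ i)`-submodule for the pairing `deg (a b)` on the whole of
`CH(M)`, with the degree map extended by zero. -/
def orthogonal (N : Submodule (M ＼ {i}).AugChow M.AugChow) :
    Submodule (M ＼ {i}).AugChow M.AugChow where
  carrier := {z | ∀ a ∈ N, chowDeg M (z * a) = 0}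
  add_mem' hz hz' a ha := by rw [add_mul, map_add, hz a ha, hz' a ha, add_zero]
  zero_mem' a _ := by rw [zero_mul, map_zero]
  smul_mem' r z hz a ha := by
    rw [smul_mul_assoc, ← mul_smul_comm]
    exact hz _ (N.smul_mem r ha)

lemma le_orthogonal_comm : N ≤ orthogonal N' ↔ N' ≤ orthogonal N := by
  simp only [SetLike.le_def]
  exact ⟨fun h a ha b hb ↦ mul_comm b a ▸ h hb a ha, fun h a ha b hb ↦ mul_comm b a ▸ h hb a ha⟩

lemma orthogonal_top : orthogonal (⊤ : Submodule (M ＼ {i}).AugChow M.AugChow) = ⊥ :=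
  eq_bot_iff.2 fun _ hz ↦ eq_zero_of_forall_chowDeg fun _ ↦ hz _ trivial

lemma poincareOrthogonal_of_le_orthogonal (h : N ≤ orthogonal N') :
    PoincareOrthogonal (degMap M) N N' :=
  fun _ _ _ _ b ha hb ↦ h ha b.1 hb

lemma eq_bot_of_le_orthogonal (hi : i ∈ M.E) (h : ∀ p, N ≤ orthogonal (M.summandColoop i p)) :
    N = ⊥ := by
  rw [eq_bot_iff, ← orthogonal_top, ← iSup_summandColoop hi]
  exact le_orthogonal_comm.1 (iSup_le fun p ↦ le_orthogonal_comm.1 (h p))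

lemma chowDeg_summandGen_inr_mul (F : ↥(M.deletionFlats i)) {q : Fin 2 ⊕ ↥(M.deletionFlats i)}
    (hq : q ≠ Sum.inr F) (r : (M ＼ {i}).AugChow) :
    chowDeg M (summandGen M i (Sum.inr F) * summandGen M i q * M.theta i r) = 0 := by
  change chowDeg M (M.chowX (insert i F.1) * _ * _) = 0
  rcases q with q | G
  · fin_cases q
    · change chowDeg M (M.chowX (insert i F.1) * 1 * _) = 0
      rw [mul_one, chowDeg_chowX_insert_mul_theta F.2]
    · change chowDeg M (M.chowX (insert i F.1) * M.chowX (M.E \ {i}) * _) = 0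
      rw [mul_comm (M.chowX (insert i F.1)), chowX_sdiff_mul_chowX_insert F.2, zero_mul, map_zero]
  · obtain ⟨H, hH, t, ht⟩ := exists_chowX_insert_mul_chowX_insert_eq F.2 G.2
      fun h ↦ hq (congrArg Sum.inr (Subtype.ext h.symm))
    change chowDeg M (M.chowX (insert i F.1) * M.chowX (insert i G.1) * _) = 0
    rw [ht, mul_assoc, ← map_mul, chowDeg_chowX_insert_mul_theta hH]

lemma summandColoop_inr_le_orthogonal {F : ↥(M.deletionFlats i)}
    {q : Fin 2 ⊕ ↥(M.deletionFlats i)} (hq : q ≠ Sum.inr F) :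
    M.summandColoop i (Sum.inr F) ≤ orthogonal (M.summandColoop i q) := by
  intro a ha b hb
  obtain ⟨r, rfl⟩ := mem_summandColoop.1 ha
  obtain ⟨s, rfl⟩ := mem_summandColoop.1 hb
  rw [mul_mul_mul_comm, ← map_mul, chowDeg_summandGen_inr_mul F hq]

lemma summandColoop_le_orthogonal {p q : Fin 2 ⊕ ↥(M.deletionFlats i)} (hpq : p ≠ q)
    (h : ¬ (p.isLeft ∧ q.isLeft)) : M.summandColoop i p ≤ orthogonal (M.summandColoop i q) := by
  rcases p with p | F
  · rcases q with q | G
    · exact absurd ⟨rfl, rfl⟩ h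
    · exact le_orthogonal_comm.1 (summandColoop_inr_le_orthogonal hpq)
  · exact summandColoop_inr_le_orthogonal hpq.symm

end Orthogonality

section Independence

variable {M : Matroid α} [M.Finite] {i : α}

omit [M.Finite] in
lemma isColoop_of_isFlat_sdiff (hi : i ∈ M.E) (h : M.IsFlat (M.E \ {i})) : M.IsColoop i :=
  (isColoop_iff_notMem_closure_compl hi).2 fun h' ↦ (h.closure ▸ h').2 rfl

lemma chowX_sdiff_of_not_isColoop (hi : i ∈ M.E) (hc : ¬ M.IsColoop i) :
    M.chowX (M.E \ {i}) = 0 :=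
  M.chowX_of_not fun h ↦ hc (isColoop_of_isFlat_sdiff hi h.1)

lemma summandColoop_inl_one_eq_bot (hi : i ∈ M.E) (hc : ¬ M.IsColoop i) :
    M.summandColoop i (Sum.inl 1) = ⊥ := by
  rw [summandColoop_eq_span, Submodule.span_singleton_eq_bot]
  exact chowX_sdiff_of_not_isColoop hi hc

variable [M.Loopless]

lemma disjoint_summandColoop_inl (hi : i ∈ M.E) :
    Disjoint (M.summandColoop i (Sum.inl 0)) (M.summandColoop i (Sum.inl 1)) := by
  by_cases hc : M.IsColoop i
  · refine disjoint_iff.2 (eq_bot_of_le_orthogonal hi fun p ↦ ?_)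
    rcases p with p | F
    · rintro z ⟨hz₀, hz₁⟩ a ha
      obtain ⟨r, rfl⟩ := mem_summandColoop.1 ha
      obtain ⟨s, hs : z = 1 * M.theta i s⟩ := mem_summandColoop.1 hz₀
      obtain ⟨s', hs' : z = M.chowX (M.E \ {i}) * M.theta i s'⟩ := mem_summandColoop.1 hz₁
      rw [one_mul] at hs
      fin_cases p
      · change chowDeg M (z * (1 * M.theta i r)) = 0
        rw [hs, one_mul, ← map_mul, chowDeg_theta_of_isColoop hc]
      · change chowDeg M (z * (M.chowX (M.E \ {i}) * M.theta i r)) = 0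
        have hz : z * (M.chowX (M.E \ {i}) * M.theta i r) =
            M.theta i (s * -chowH (M ＼ {i}) (M.E \ {i}) * r) := by
          rw [map_mul, map_mul, ← hs, hs']
          linear_combination M.theta i s' * M.theta i r * chowX_sdiff_mul_self hi
        rw [hz, chowDeg_theta_of_isColoop hc]
    · exact inf_le_left.trans
        (le_orthogonal_comm.1 (summandColoop_inr_le_orthogonal Sum.inl_ne_inr))
  · rw [summandColoop_inl_one_eq_bot hi hc]
    exact disjoint_bot_right

lemma disjoint_sup_iSup_summandColoop_inr (hi : i ∈ M.E) :
    Disjoint (M.summandColoop i (Sum.inl 0) ⊔ M.summandColoop i (Sum.inl 1))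
      (⨆ F, M.summandColoop i (Sum.inr F)) := by
  refine disjoint_iff.2 (eq_bot_of_le_orthogonal hi fun p ↦ ?_)
  rcases p with p | F
  · exact inf_le_right.trans (iSup_le fun F ↦ summandColoop_inr_le_orthogonal Sum.inl_ne_inr)
  · exact inf_le_left.trans (sup_le
      (le_orthogonal_comm.1 (summandColoop_inr_le_orthogonal Sum.inl_ne_inr))
      (le_orthogonal_comm.1 (summandColoop_inr_le_orthogonal Sum.inl_ne_inr)))

lemma disjoint_summandColoop_inr (hi : i ∈ M.E) (F : ↥(M.deletionFlats i)) :
    Disjoint (M.summandColoop i (Sum.inr F)) (⨆ q, ⨆ _ : q ≠ Sum.inr F, M.summandColoop i q) := by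
  refine disjoint_iff.2 (eq_bot_of_le_orthogonal hi fun p ↦ ?_)
  rcases eq_or_ne p (Sum.inr F) with rfl | hp
  · exact inf_le_right.trans (iSup₂_le fun q hq ↦
      le_orthogonal_comm.1 (summandColoop_inr_le_orthogonal hq))
  · exact inf_le_left.trans (summandColoop_inr_le_orthogonal hp)

lemma iSupIndep_summandColoop (hi : i ∈ M.E) : iSupIndep (M.summandColoop i) := by
  have h₀ := (disjoint_summandColoop_inl hi).disjoint_sup_right_of_disjoint_sup_left
    (disjoint_sup_iSup_summandColoop_inr hi)
  have h₁ := (disjoint_summandColoop_inl hi).symm.disjoint_sup_right_of_disjoint_sup_left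
    (sup_comm (M.summandColoop i (Sum.inl 0)) _ ▸ disjoint_sup_iSup_summandColoop_inr hi)
  have hle (F) := le_iSup (fun F ↦ M.summandColoop i (Sum.inr F)) F
  rintro (p | F)
  · fin_cases p
    · refine h₀.mono_right (iSup₂_le ?_)
      rintro (q | F) hq
      · fin_cases q
        · exact absurd rfl hq
        · exact le_sup_left
      · exact (hle F).trans le_sup_right
    · refine h₁.mono_right (iSup₂_le ?_)
      rintro (q | F) hq
      · fin_cases q
        · exact le_sup_left
        · exact absurd rfl hq
      · exact (hle F).trans le_sup_right
  · exact disjoint_summandColoop_inr hi F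

lemma isInternal_summandColoop [DecidableEq (Fin 2 ⊕ ↥(M.deletionFlats i))] (hi : i ∈ M.E) :
    DirectSum.IsInternal (M.summandColoop i) :=
  DirectSum.isInternal_submodule_of_iSupIndep_of_iSup_eq_top (iSupIndep_summandColoop hi)
    (iSup_summandColoop hi)

end Independence

section LocalRing

variable {M : Matroid α} [M.Finite] [M.Loopless]

lemma chowX_ne_zero {F : Set α} (hF : M.IsFlat F) (hFE : F ≠ M.E) : M.chowX F ≠ 0 := by
  intro h
  have hpow := chowH_ground_pow_mul_chowX hF hFE
  have hdeg := chowDeg_chowH_ground_pow M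
  rw [← hpow, h, zero_mul, mul_zero, map_zero] at hdeg
  exact zero_ne_one hdeg

instance : Nontrivial M.AugChow := by
  refine ⟨1, 0, fun h ↦ ?_⟩
  have hdeg := chowDeg_chowH_ground_pow M
  rw [← mul_one (chowH M M.E ^ _), h, mul_zero, map_zero] at hdeg
  exact zero_ne_one hdeg

lemma isNilpotent_of_mem_chowGr_succ {k : ℕ} {a : M.AugChow} (ha : a ∈ M.chowGr (k + 1)) :
    IsNilpotent a := by
  refine ⟨M.natRank + 1, eq_zero_of_mem_chowGr (k := (k + 1) * (M.natRank + 1)) (by nlinarith) ?_⟩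
  rw [← chowGr_one_pow, pow_mul, chowGr_one_pow]
  exact Submodule.pow_mem_pow _ ha _

lemma exists_eq_algebraMap_add_isNilpotent (z : M.AugChow) :
    ∃ (c : ℚ) (n : M.AugChow), IsNilpotent n ∧ z = algebraMap ℚ M.AugChow c + n := by
  induction z using chowGr_induction with
  | add _ _ ha hb =>
    obtain ⟨c, n, hn, rfl⟩ := ha
    obtain ⟨c', n', hn', rfl⟩ := hb
    exact ⟨c + c', n + n', (Commute.all n n').isNilpotent_add hn hn', by rw [map_add]; ring⟩
  | mem k a ha =>
    rcases k with _ | k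
    · obtain ⟨c, rfl⟩ := exists_algebraMap_of_mem_chowGr_zero ha
      exact ⟨c, 0, IsNilpotent.zero, (add_zero _).symm⟩
    · exact ⟨0, a, isNilpotent_of_mem_chowGr_succ ha, by rw [map_zero, zero_add]⟩

instance : IsLocalRing M.AugChow := by
  refine IsLocalRing.of_isUnit_or_isUnit_one_sub_self fun z ↦ ?_
  obtain ⟨c, n, hn, rfl⟩ := exists_eq_algebraMap_add_isNilpotent z
  rcases eq_or_ne c 0 with rfl | hc
  · right
    rw [map_zero, zero_add]
    exact hn.isUnit_one_sub
  · exact Or.inl (hn.isUnit_add_left_of_commute (hc.isUnit.map (algebraMap ℚ M.AugChow))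
      (Commute.all _ _))

end LocalRing

section CyclicSubmodule

variable {R A : Type*} [CommRing R] [AddCommGroup A] [Module R A] {v : A}

lemma eq_bot_of_disjoint_of_sup_eq_span_singleton {N N' : Submodule R A} (hd : Disjoint N N')
    (hs : N ⊔ N' = Submodule.span R {v}) (h : v ∈ N) : N' = ⊥ :=
  disjoint_self.1 (hd.mono_left ((le_sup_right.trans hs.le).trans
    ((Submodule.span_singleton_le_iff_mem _ _).2 h)))

lemma isIndecomposableSubmodule_span_singleton [IsLocalRing R] (hv : v ≠ 0) :
    IsIndecomposableSubmodule (Submodule.span R {v}) := by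
  refine ⟨fun h ↦ hv (Submodule.span_singleton_eq_bot.1 h), fun N₁ N₂ hd hs ↦ ?_⟩
  obtain ⟨a, ha, b, hb, hab⟩ := Submodule.mem_sup.1 (hs ▸ Submodule.mem_span_singleton_self v)
  obtain ⟨r, rfl⟩ := Submodule.mem_span_singleton.1 (hs ▸ Submodule.mem_sup_left ha)
  obtain rfl : b = (1 - r) • v := by
    rw [sub_smul, one_smul]
    exact eq_sub_of_add_eq' hab
  rcases IsLocalRing.isUnit_or_isUnit_one_sub_self r with h | h
  · exact Or.inr (eq_bot_of_disjoint_of_sup_eq_span_singleton hd hs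
      ((Submodule.smul_mem_iff_of_isUnit _ h).1 ha))
  · exact Or.inl (eq_bot_of_disjoint_of_sup_eq_span_singleton hd.symm (sup_comm N₁ N₂ ▸ hs)
      ((Submodule.smul_mem_iff_of_isUnit _ h).1 hb))

end CyclicSubmodule

section Summands

variable {M : Matroid α} [M.Finite] {i : α}

lemma isGradedSubmodule_span_singleton {a : M.AugChow} {k : ℕ} (ha : a ∈ M.chowGr k) :
    IsGradedSubmodule (Submodule.span (M ＼ {i}).AugChow {a}) := by
  intro z hz
  obtain ⟨r, rfl⟩ := Submodule.mem_span_singleton.1 hz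
  clear hz
  induction r using chowGr_induction with
  | add r s hr hs =>
    obtain ⟨c, hc, hcr⟩ := hr
    obtain ⟨c', hc', hcs⟩ := hs
    refine ⟨c + c', fun l ↦ ⟨add_mem (hc l).1 (hc' l).1, add_mem (hc l).2 (hc' l).2⟩, ?_⟩
    rw [Finsupp.sum_add_index' (fun _ ↦ rfl) fun _ _ _ ↦ rfl, hcr, hcs, add_smul]
  | mem l r hr =>
    refine ⟨Finsupp.single (l + k) (r • a), fun m ↦ ?_, Finsupp.sum_single_index rfl⟩
    rw [Finsupp.single_apply]
    split_ifs with h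
    · refine ⟨?_, Submodule.smul_mem _ r (Submodule.mem_span_singleton_self a)⟩
      rw [smul_eq_theta_mul]
      exact M.chowGr_mul_mem h (theta_mem_chowGr hr) ha
    · exact ⟨zero_mem _, zero_mem _⟩

lemma exists_summandGen_mem_chowGr (p : Fin 2 ⊕ ↥(M.deletionFlats i)) :
    ∃ k, summandGen M i p ∈ M.chowGr k := by
  rcases p with p | F
  · fin_cases p
    · exact ⟨0, show 1 ∈ M.chowGr 0 from pow_zero (chowH M ∅) ▸ chowH_pow_mem_chowGr M ∅ 0⟩
    · exact ⟨1, chowX_mem_chowGr M _⟩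
  · exact ⟨1, chowX_mem_chowGr M _⟩

lemma isGradedSubmodule_summandColoop (p : Fin 2 ⊕ ↥(M.deletionFlats i)) :
    IsGradedSubmodule (M.summandColoop i p) := by
  obtain ⟨k, hk⟩ := exists_summandGen_mem_chowGr p
  exact summandColoop_eq_span M i p ▸ isGradedSubmodule_span_singleton hk

lemma isPrincipal_summandColoop (p : Fin 2 ⊕ ↥(M.deletionFlats i)) :
    (M.summandColoop i p).IsPrincipal :=
  ⟨summandGen M i p, summandColoop_eq_span M i p⟩

variable [M.Loopless]

lemma summandGen_ne_zero (hi : i ∈ M.E) {p : Fin 2 ⊕ ↥(M.deletionFlats i)}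
    (hp : p = Sum.inl 1 → M.IsColoop i) : summandGen M i p ≠ 0 := by
  rcases p with p | F
  · fin_cases p
    · exact one_ne_zero
    · exact chowX_ne_zero (isFlat_sdiff_of_isColoop (hp rfl)) (sdiff_singleton_ssubset.2 hi).ne
  · refine chowX_ne_zero F.2.2.2 fun h ↦ ?_
    obtain ⟨f, ⟨hfE, hfi⟩, hfF⟩ := exists_of_ssubset F.2.1
    exact (h.symm.subset hfE).elim hfi hfF

lemma isIndecomposableSubmodule_summandColoop (hi : i ∈ M.E) {p : Fin 2 ⊕ ↥(M.deletionFlats i)}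
    (hp : p = Sum.inl 1 → M.IsColoop i) : IsIndecomposableSubmodule (M.summandColoop i p) := by
  have : (M ＼ {i}).Loopless := (M.delete_isRestriction {i}).loopless
  exact summandColoop_eq_span M i p ▸
    isIndecomposableSubmodule_span_singleton (summandGen_ne_zero hi hp)

lemma not_poincareOrthogonal_of_isColoop (hc : M.IsColoop i) :
    ¬ PoincareOrthogonal (degMap M) (M.summandColoop i (Sum.inl 0))
      (M.summandColoop i (Sum.inl 1)) := by
  intro h
  let H := M.E \ {i}
  have hssub : H ⊂ M.E := sdiff_singleton_ssubset.2 hc.mem_ground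
  have hH : M.IsFlat H := isFlat_sdiff_of_isColoop hc
  have hrk : natRk M H + 1 = M.natRank := by
    have hlt := natRk_lt_of_ssubset hH hssub subset_rfl
    have hle := natRk_insert_le M i H
    rw [insert_sdiff_self_of_mem hc.mem_ground] at hle
    rw [natRk_ground] at hlt hle
    omega
  have hpow := chowH_ground_pow_mul_chowX hH hssub.ne
  rw [show M.natRank - natRk M H - 1 = 0 by omega, pow_zero, one_mul, mul_comm] at hpow
  have hpow_mem : chowH M H ^ natRk M H ∈ M.summandColoop i (Sum.inl 0) :=
    mem_summandColoop.2 ⟨chowH (M ＼ {i}) H ^ natRk M H, by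
      rw [map_pow, theta_chowH subset_rfl]
      exact (one_mul _).symm⟩
  have hx_mem : M.chowX H ∈ M.summandColoop i (Sum.inl 1) := mem_summandColoop.2 ⟨1, by
    rw [map_one, mul_one]
    rfl⟩
  have hzero : chowDeg M (chowH M H ^ natRk M H * M.chowX H) = 0 :=
    h _ 1 hrk ⟨_, chowH_pow_mem_chowGr M H _⟩ ⟨_, chowX_mem_chowGr M H⟩ hpow_mem hx_mem
  rw [hpow, chowDeg_chowH_ground_pow] at hzero
  exact one_ne_zero hzero

end Summands

section NonColoop

variable (M : Matroid α) [M.Finite] (i : α)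

/-- The indices of the summands of the non-coloop case among those of the coloop case, whose
second summand `x_{E ∖ i} CH_(i)` vanishes if `i` is not a coloop. -/
def summandIndex : Unit ⊕ ↥(M.deletionFlats i) → Fin 2 ⊕ ↥(M.deletionFlats i) :=
  Sum.map (fun _ ↦ 0) id

omit [M.Finite] in
lemma summandIndex_injective : Function.Injective (summandIndex M i) :=
  Function.Injective.sumMap (fun _ _ _ ↦ rfl) Function.injective_id

lemma summand_eq_comp : M.summand i = M.summandColoop i ∘ summandIndex M i := by
  funext p
  rcases p with _ | F <;> rfl

variable {M i}

omit [M.Finite] in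
lemma summandIndex_ne_inl_one (p : Unit ⊕ ↥(M.deletionFlats i)) :
    summandIndex M i p ≠ Sum.inl 1 := by
  rcases p with _ | F <;> simp [summandIndex]

lemma iSup_summand (hi : i ∈ M.E) (hc : ¬ M.IsColoop i) : ⨆ p, M.summand i p = ⊤ := by
  refine eq_top_iff.2 ((iSup_summandColoop hi).ge.trans (iSup_le fun p ↦ ?_))
  rcases p with p | F
  · fin_cases p
    · exact le_iSup (M.summand i) (Sum.inl ())
    · exact (summandColoop_inl_one_eq_bot hi hc).trans_le bot_le
  · exact le_iSup (M.summand i) (Sum.inr F)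

variable [M.Loopless]

lemma isInternal_summand [DecidableEq (Unit ⊕ ↥(M.deletionFlats i))] (hi : i ∈ M.E)
    (hc : ¬ M.IsColoop i) : DirectSum.IsInternal (M.summand i) := by
  refine DirectSum.isInternal_submodule_of_iSupIndep_of_iSup_eq_top ?_ (iSup_summand hi hc)
  rw [summand_eq_comp]
  exact (iSupIndep_summandColoop hi).comp (summandIndex_injective M i)

lemma summand_le_orthogonal {p q : Unit ⊕ ↥(M.deletionFlats i)} (hpq : p ≠ q) :
    M.summand i p ≤ orthogonal (M.summand i q) := by
  rw [summand_eq_comp]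
  refine summandColoop_le_orthogonal ((summandIndex_injective M i).ne hpq) fun h ↦ hpq ?_
  rcases p with _ | F <;> rcases q with _ | G <;> simp_all [summandIndex]

end NonColoop

end AugmentedChow

end

open scoped Classical in
theorem theorem1p2 {α : Type*} (M : Matroid α) [M.Finite] [M.Loopless] (i : α) (hi : i ∈ M.E) :
    ∃ deg : M.chowGr M.natRank →ₗ[ℚ] ℚ,
      M.IsDegreeMap deg ∧ (∀ deg', M.IsDegreeMap deg' → deg' = deg) ∧
      (¬ M.IsColoop i →
        DirectSum.IsInternal (M.summand i) ∧
        (∀ p, Matroid.IsGradedSubmodule (M.summand i p) ∧ (M.summand i p).IsPrincipal ∧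
          Matroid.IsIndecomposableSubmodule (M.summand i p)) ∧
        (∀ p q, p ≠ q → Matroid.PoincareOrthogonal deg (M.summand i p) (M.summand i q))) ∧
      (M.IsColoop i →
        DirectSum.IsInternal (M.summandColoop i) ∧
        (∀ p, Matroid.IsGradedSubmodule (M.summandColoop i p) ∧
          (M.summandColoop i p).IsPrincipal ∧
          Matroid.IsIndecomposableSubmodule (M.summandColoop i p)) ∧
        (∀ p q, p ≠ q → ¬ (p.isLeft ∧ q.isLeft) →
          Matroid.PoincareOrthogonal deg (M.summandColoop i p) (M.summandColoop i q)) ∧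
        ¬ Matroid.PoincareOrthogonal deg
          (M.summandColoop i (Sum.inl 0)) (M.summandColoop i (Sum.inl 1))) := by
  refine ⟨AugmentedChow.degMap M, AugmentedChow.isDegreeMap_degMap M,
    fun _ h ↦ AugmentedChow.eq_degMap_of_isDegreeMap h, fun hc ↦ ⟨?_, fun p ↦ ?_, fun p q hpq ↦ ?_⟩,
    fun hc ↦ ⟨?_, fun p ↦ ⟨?_, ?_, ?_⟩, fun p q hpq h ↦ ?_, ?_⟩⟩
  · exact AugmentedChow.isInternal_summand hi hc
  · rw [AugmentedChow.summand_eq_comp]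
    exact ⟨AugmentedChow.isGradedSubmodule_summandColoop _,
      AugmentedChow.isPrincipal_summandColoop _,
      AugmentedChow.isIndecomposableSubmodule_summandColoop hi
        fun h ↦ absurd h (AugmentedChow.summandIndex_ne_inl_one p)⟩
  · exact AugmentedChow.poincareOrthogonal_of_le_orthogonal
      (AugmentedChow.summand_le_orthogonal hpq)
  · exact AugmentedChow.isInternal_summandColoop hi
  · exact AugmentedChow.isGradedSubmodule_summandColoop p
  · exact AugmentedChow.isPrincipal_summandColoop p
  · exact AugmentedChow.isIndecomposableSubmodule_summandColoop hi fun _ ↦ hc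
  · exact AugmentedChow.poincareOrthogonal_of_le_orthogonal
      (AugmentedChow.summandColoop_le_orthogonal hpq h)
  · exact AugmentedChow.not_poincareOrthogonal_of_isColoop hc
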